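/- Let $m\ge 0$, $\nu>0$, and let $\Omega_i\subset\mathbb R^2$ be a pore subdomain with a finite conforming triangulation into nondegenerate triangles (straight edges), connected in the sense that any two triangles are joined by a chain of triangles in which consecutive ones share an edge. The boundary edges (edges of exactly one triangle) are split into $m$ pairwise disjoint nonempty sets of edges, the interfaces $\Gamma_{i,1},\dots,\Gamma_{i,m}$, and the remaining boundary edges, the solid wall, of which there is at least one. Let $\{\boldsymbol\phi_j\}$ be the vector-valued Lagrange basis (scalar nodal functions at vertices and edge midpoints times the two coordinate vectors) of the space of continuous piecewise quadratic velocities on $\Omega_i$ that vanish on the wall, and $\{\psi_l\}$ the nodal basis of the continuous piecewise linear pressures on $\Omega_i$ (Taylor–Hood elements). Put $$A_{jk}=\nu\int_{\Omega_i}\nabla\boldsymbol\phi_k:\nabla\boldsymbol\phi_j\,dx,\qquad B_{lj}=-\int_{\Omega_i}\psi_l\,\nabla\!\cdot\boldsymbol\phi_j\,dx,\qquad \bigl(\mathbf f^{(r)}\bigr)_j=-\int_{\Gamma_{i,r}}\boldsymbol\phi_j\cdot\mathbf n\,ds\quad(r=1,\dots,m),$$ where $\mathbf n$ is the outward unit normal.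 For each $r$ let $(\widetilde{\mathbf f}^{(r)},\mathbf X^{(r)})$ be a solution of the discrete Stokes problem with unit normal traction on $\Gamma_{i,r}$ and zero traction on the other interfaces, $$\begin{bmatrix}A&B^\top\\ B&0\end{bmatrix}\begin{bmatrix}\widetilde{\mathbf f}^{(r)}\\ \mathbf X^{(r)}\end{bmatrix}=\begin{bmatrix}\mathbf f^{(r)}\\ \mathbf 0\end{bmatrix},$$ and let $G_i\in\mathbb R^{m\times m}$, $(G_i)_{kr}=-\,[\mathbf f^{(k)}]^\top\widetilde{\mathbf f}^{(r)}$, be the local Dirichlet-to-Neumann matrix. Then: 1. Such solutions exist, and $G_i$ does not depend on their choice; so $G_i$ is well defined. 2. $G_i\mathbf 1=\mathbf 0$, where $\mathbf 1\in\mathbb R^m$ is the all-ones vector. 3. For every $\mathbf p=(p_1,\dots,p_m)^\top\in\mathbb R^m$: $\ \mathbf p^\top G_i\,\mathbf p=0$ if and only if the interface traction is uniform, i.e. $p_1=\dots=p_m$. -/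

import Mathlib

noncomputable section

/-- The Euclidean plane. -/
abbrev Plane : Type := EuclideanSpace ℝ (Fin 2)

/-- The edge `e` of the complex `K` is a boundary edge: it belongs to exactly one triangle. -/
def IsBoundaryEdge (K : Geometry.SimplicialComplex ℝ Plane) (e : Finset Plane) : Prop :=
  e ∈ K.faces ∧ e.card = 2 ∧ ∃! T : Finset Plane, T ∈ K.faces ∧ T.card = 3 ∧ e ⊆ T

/-- A pore subdomain with `m` interfaces, together with a body-fitted conforming triangulation:
a finite pure two-dimensional simplicial complex `K` in the plane, connected through edges (any two
triangles are joined by a chain of triangles in which consecutive ones share an edge), and `m`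
pairwise disjoint nonempty sets of boundary edges, the interfaces. The boundary edges that lie on
no interface form the solid wall, which has at least one edge. -/
structure PoreMesh (m : ℕ) where
  K : Geometry.SimplicialComplex ℝ Plane
  finite_faces : K.faces.Finite
  pure_dim_two : ∀ s ∈ K.faces, ∃ T ∈ K.faces, T.card = 3 ∧ s ⊆ T
  connected : ∀ T ∈ K.faces, T.card = 3 → ∀ T' ∈ K.faces, T'.card = 3 →
    Relation.ReflTransGen
      (fun A B : Finset Plane => B ∈ K.faces ∧ B.card = 3 ∧
        ∃ e ∈ K.faces, e.card = 2 ∧ e ⊆ A ∧ e ⊆ B) T T'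
  iface : Fin m → Finset (Finset Plane)
  iface_boundary : ∀ r, ∀ e ∈ iface r, IsBoundaryEdge K e
  iface_nonempty : ∀ r, (iface r).Nonempty
  iface_disjoint : ∀ r s, r ≠ s → Disjoint (iface r) (iface s)
  wall_nonempty : ∃ e, IsBoundaryEdge K e ∧ ∀ r, e ∉ iface r

namespace PoreMesh

variable {m : ℕ} (S : PoreMesh m)

/-- The boundary edges on the solid wall. -/
def IsWallEdge (e : Finset Plane) : Prop :=
  IsBoundaryEdge S.K e ∧ ∀ r, e ∉ S.iface r

/-- The triangles of the mesh. -/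
def Cell : Type := {T : Finset Plane // T ∈ S.K.faces ∧ T.card = 3}

/-- The pressure nodes: the vertices of the mesh. -/
def PNode : Type := {v : Plane // {v} ∈ S.K.faces}

/-- The free velocity nodes: the vertices and the edges (each edge standing for its midpoint) that
are not contained in the closed solid wall. -/
def UNode : Type :=
  {s : Finset Plane // s ∈ S.K.faces ∧ s.card ≤ 2 ∧ ∀ e, S.IsWallEdge e → ¬ s ⊆ e}

/-- The velocity degrees of freedom: a free node and a component. -/
abbrev UDof : Type := S.UNode × Fin 2

instance : Finite S.K.faces := S.finite_faces

instance : Finite S.Cell :=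
  Finite.of_injective (fun T : S.Cell => (⟨T.1, T.2.1⟩ : S.K.faces))
    fun _ _ h => Subtype.ext (congrArg (fun s : S.K.faces => s.1) h)

instance : Finite S.PNode :=
  Finite.of_injective (fun v : S.PNode => (⟨{v.1}, v.2⟩ : S.K.faces))
    fun _ _ h => Subtype.ext (Finset.singleton_injective (congrArg (fun s : S.K.faces => s.1) h))

instance : Finite S.UNode :=
  Finite.of_injective (fun s : S.UNode => (⟨s.1, s.2.1⟩ : S.K.faces))
    fun _ _ h => Subtype.ext (congrArg (fun s : S.K.faces => s.1) h)

instance : Fintype S.Cell := Fintype.ofFinite _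
instance : Fintype S.PNode := Fintype.ofFinite _
instance : Fintype S.UNode := Fintype.ofFinite _

variable {S}

/-- The three vertices of a triangle as an affine basis of the plane. -/
def Cell.basis (T : S.Cell) : AffineBasis T.1 ℝ Plane where
  toFun := fun v => v.1
  ind' := S.K.indep T.2.1
  tot' := by
    rw [(S.K.indep T.2.1).affineSpan_eq_top_iff_card_eq_finrank_add_one]
    simp [T.2.2]

open Classical in
/-- The barycentric coordinate of the triangle `T` that belongs to `v`; it is `0` if `v` is not a
vertex of `T`. It is the restriction to `T` of the piecewise linear hat function of `v`, extended
to an affine function on the plane. -/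
def Cell.bary (T : S.Cell) (v : Plane) : Plane →ᵃ[ℝ] ℝ :=
  if h : v ∈ T.1 then T.basis.coord ⟨v, h⟩ else 0

/-- The quadratic Lagrange basis function of the node `s` on the triangle `T`: `λ (2 λ - 1)` for a
vertex and `4 λ μ` for an edge (it is `0` if `s` is not contained in `T`). -/
def Cell.quad (T : S.Cell) (s : Finset Plane) (x : Plane) : ℝ :=
  if s.card = 1 then (∏ v ∈ s, T.bary v x) * (2 * (∏ v ∈ s, T.bary v x) - 1)
  else 4 * ∏ v ∈ s, T.bary v x

/-- The vector-valued velocity basis function of the degree of freedom `j` on the triangle `T`. -/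
def Cell.velBasis (T : S.Cell) (j : S.UDof) (x : Plane) : Plane :=
  EuclideanSpace.single j.2 (T.quad j.1.1 x)

/-- The Frobenius product `∇u : ∇v` at `x`. -/
def _root_.gradProd (u v : Plane → Plane) (x : Plane) : ℝ :=
  ∑ i : Fin 2, ∑ k : Fin 2,
    (fderiv ℝ u x (EuclideanSpace.single k 1)) i * (fderiv ℝ v x (EuclideanSpace.single k 1)) i

/-- The divergence of `u` at `x`. -/
def _root_.planeDiv (u : Plane → Plane) (x : Plane) : ℝ :=
  ∑ i : Fin 2, (fderiv ℝ u x (EuclideanSpace.single i 1)) i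

/-- The unit normal on the edge `e` of the triangle `T` that points out of `T`: the sum of the
barycentric coordinates of the two endpoints is `1` on `e` and decreases into `T`, and its
gradient is constant. -/
def Cell.outNormal (T : S.Cell) (e : Finset Plane) : Plane :=
  (‖∑ v ∈ e, gradient (T.bary v) 0‖)⁻¹ • ∑ v ∈ e, gradient (T.bary v) 0

variable (S)

/-- The stiffness matrix, `A_{jk} = ν ∫ ∇φ_k : ∇φ_j`. -/
def stiffness (ν : ℝ) : Matrix S.UDof S.UDof ℝ :=
  Matrix.of fun j k => ν * ∑ T : S.Cell, ∫ x in convexHull ℝ (T.1 : Set Plane),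
    gradProd (T.velBasis k) (T.velBasis j) x

/-- The divergence matrix, `B_{lj} = - ∫ ψ_l div φ_j`. -/
def divMatrix : Matrix S.PNode S.UDof ℝ :=
  Matrix.of fun l j => -∑ T : S.Cell, ∫ x in convexHull ℝ (T.1 : Set Plane),
    T.bary l.1 x * planeDiv (T.velBasis j) x

open Classical in
/-- The Neumann load vector of a unit normal traction on the interface `r`,
`(f_r)_j = - ∫_{Γ_r} φ_j · n`. The inner sum has exactly one term, that of the triangle at the
boundary edge `e`; the integral is with respect to arc length. -/
def load (r : Fin m) : S.UDof → ℝ := fun j =>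
  -∑ e ∈ S.iface r, ∑ T : S.Cell with e ⊆ T.1,
    ∫ x in convexHull ℝ (e : Set Plane), inner ℝ (T.velBasis j x) (T.outNormal e)
      ∂(MeasureTheory.Measure.hausdorffMeasure 1 : MeasureTheory.Measure Plane)

/-- The discrete velocity and pressure coefficients `U`, `P` solve the local Stokes system with unit
normal traction on the interface `r` and zero traction on the other interfaces. -/
def IsUnitResponse (ν : ℝ) (r : Fin m) (U : S.UDof → ℝ) (P : S.PNode → ℝ) : Prop :=
  (Matrix.fromBlocks (S.stiffness ν) S.divMatrix.transpose S.divMatrix 0).mulVec (Sum.elim U P) =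
    Sum.elim (S.load r) 0

/-- `G` is the local Dirichlet-to-Neumann matrix: `g_{kr} = - f_k · U_r`, where `U_r` is the velocity
part of a unit response on the interface `r`. -/
def IsDtN (ν : ℝ) (G : Matrix (Fin m) (Fin m) ℝ) : Prop :=
  ∃ (U : Fin m → S.UDof → ℝ) (P : Fin m → S.PNode → ℝ),
    (∀ r, S.IsUnitResponse ν r (U r) (P r)) ∧ ∀ k r, G k r = -(S.load k ⬝ᵥ U r)

end PoreMesh

end

/-! The stiffness matrix `A` is symmetric and definite (`stiffness_definite`): zero energy makes
each velocity component constant on every triangle, and the value zero spreads from a wall edge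
through the edge-connected mesh. A kernel vector of the saddle-point matrix therefore has zero
velocity part and is orthogonal to every right-hand side `(f, 0)`. So the symmetric system is
solvable, and its velocity is unique. No inf-sup condition enters: pressures may differ, but `G`
sees only velocities.

Summing the divergence theorem over the triangles gives `∑ f_r = Bᵀ 1` (`sum_load_eq`). A uniform
traction is thus balanced by a constant pressure at zero velocity, whence `G 1 = 0`.

With `U = ∑ p_r U_r` the form `pᵀ G p` equals `-Uᵀ A U`. If it vanishes, then `U = 0` and `∑ p_r f_r
= Bᵀ P` for some pressure `P`. This identity is tested with the quadratic function of the midpoint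
of an edge off the wall. The tangential component feels no load and shows that `P` agrees at the two
endpoints (`nodalPressure_eq_of_edge`), so one value `κ` spreads over the free edges of all
triangles. When there are two interfaces, a triangle at an interface edge has a second free edge, so
`P = κ` at its three vertices, and the normal component yields `p_r = κ`
(`nodalPressure_eq_traction`). -/

/-! ### Linear algebra of symmetric saddle-point systems. -/

/-- A symmetric system `K x = y` is solvable as soon as `y` is orthogonal to the kernel of `K`. -/
theorem Matrix.exists_mulVec_eq_of_isSymm {ι : Type*} [Fintype ι] {K : Matrix ι ι ℝ}
    (hK : K.IsSymm) {y : ι → ℝ} (hy : ∀ w, K.mulVec w = 0 → w ⬝ᵥ y = 0) :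
    ∃ x, K.mulVec x = y := by
  classical
  by_contra hne
  have hmem : y ∉ LinearMap.range K.mulVecLin := by
    rintro ⟨x, hx⟩
    exact hne ⟨x, hx⟩
  -- A functional that kills the range of `K` but not `y`; its coefficient vector `w` satisfies `wᵀ
  -- K = 0`, which by symmetry is `K w = 0`.
  obtain ⟨φ, hφy, hφ⟩ := Submodule.exists_le_ker_of_notMem hmem
  set w : ι → ℝ := fun i => φ (Pi.single i 1) with hw
  have hφw : ∀ x, φ x = w ⬝ᵥ x := by
    intro x
    conv_lhs => rw [← Finset.univ_sum_single x]
    rw [map_sum, dotProduct]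
    refine Finset.sum_congr rfl fun i _ => ?_
    have : (Pi.single i (x i) : ι → ℝ) = x i • Pi.single i 1 := by
      rw [← Pi.single_smul]; simp
    rw [this, map_smul, smul_eq_mul, mul_comm]
  refine hφy ?_
  rw [hφw]
  refine hy w ?_
  have hv : Matrix.vecMul w K = 0 := by
    refine dotProduct_eq_zero_iff.1 fun x => ?_
    rw [← Matrix.dotProduct_mulVec, ← hφw]
    exact hφ ⟨x, rfl⟩
  rw [← hK.eq, Matrix.mulVec_transpose, hv]

section SaddlePoint

variable {n l : Type*} [Fintype n] [Fintype l] {A : Matrix n n ℝ} {B : Matrix l n ℝ}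

theorem saddlePoint_mulVec_eq_iff {U f : n → ℝ} {P : l → ℝ} :
    (Matrix.fromBlocks A B.transpose B 0).mulVec (Sum.elim U P) = Sum.elim f 0 ↔
      A.mulVec U + B.transpose.mulVec P = f ∧ B.mulVec U = 0 := by
  rw [Matrix.fromBlocks_mulVec]
  simp only [Sum.elim_comp_inl, Sum.elim_comp_inr, Matrix.zero_mulVec, add_zero,
    Sum.elim_eq_iff]

theorem dotProduct_transpose_mulVec_eq_zero {U : n → ℝ} (hU : B.mulVec U = 0) (P : l → ℝ) :
    U ⬝ᵥ B.transpose.mulVec P = 0 := by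
  rw [Matrix.dotProduct_mulVec, Matrix.vecMul_transpose, hU, zero_dotProduct]

/-- Testing the first equation with `U` removes the pressure term, since `U` is discretely
divergence free, and leaves the energy of `U`. -/
theorem saddlePoint_velocity_eq_zero (hA : ∀ U, U ⬝ᵥ A.mulVec U = 0 → U = 0) {U : n → ℝ}
    {P : l → ℝ} (h : A.mulVec U + B.transpose.mulVec P = 0) (hU : B.mulVec U = 0) : U = 0 := by
  refine hA U ?_
  have := congrArg (fun z => U ⬝ᵥ z) h
  simpa [dotProduct_add, dotProduct_transpose_mulVec_eq_zero hU] using this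

/-- `B` need not have full rank: kernel vectors are pure pressures, and the right-hand side has zero
pressure block. -/
theorem exists_saddlePoint_solution (hs : A.IsSymm) (hA : ∀ U, U ⬝ᵥ A.mulVec U = 0 → U = 0)
    (f : n → ℝ) : ∃ (U : n → ℝ) (P : l → ℝ),
      A.mulVec U + B.transpose.mulVec P = f ∧ B.mulVec U = 0 := by
  have hsymm : (Matrix.fromBlocks A B.transpose B (0 : Matrix l l ℝ)).IsSymm :=
    Matrix.IsSymm.fromBlocks hs (Matrix.transpose_transpose B) (Matrix.isSymm_zero)
  obtain ⟨x, hx⟩ := Matrix.exists_mulVec_eq_of_isSymm hsymm (y := Sum.elim f 0) (by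
    intro w hw
    obtain ⟨U, P, rfl⟩ : ∃ U P, w = Sum.elim U P := ⟨_, _, (Sum.elim_comp_inl_inr w).symm⟩
    have hw' : (Matrix.fromBlocks A B.transpose B 0).mulVec (Sum.elim U P) =
        Sum.elim (0 : n → ℝ) 0 := by rw [hw]; ext (i | i) <;> rfl
    obtain ⟨h1, h2⟩ := saddlePoint_mulVec_eq_iff.1 hw'
    rw [saddlePoint_velocity_eq_zero hA h1 h2, sumElim_dotProduct_sumElim,
      zero_dotProduct, dotProduct_zero, add_zero])
  refine ⟨x ∘ Sum.inl, x ∘ Sum.inr, saddlePoint_mulVec_eq_iff.1 ?_⟩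
  rw [Sum.elim_comp_inl_inr, hx]

theorem saddlePoint_velocity_unique (hA : ∀ U, U ⬝ᵥ A.mulVec U = 0 → U = 0)
    {U U' f : n → ℝ} {P P' : l → ℝ}
    (h : A.mulVec U + B.transpose.mulVec P = f) (hU : B.mulVec U = 0)
    (h' : A.mulVec U' + B.transpose.mulVec P' = f) (hU' : B.mulVec U' = 0) : U = U' := by
  rw [← sub_eq_zero]
  refine saddlePoint_velocity_eq_zero (P := P - P') hA ?_ (by rw [Matrix.mulVec_sub, hU, hU', sub_zero])
  rw [Matrix.mulVec_sub, Matrix.mulVec_sub, sub_add_sub_comm, h, h', sub_self]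

variable {m : ℕ} {f U : Fin m → n → ℝ} {P : Fin m → l → ℝ}

/-- Superposition: the combination of the solutions solves for the combination of the loads. -/
theorem saddlePoint_superposition
    (h : ∀ r, A.mulVec (U r) + B.transpose.mulVec (P r) = f r) (hU : ∀ r, B.mulVec (U r) = 0)
    (p : Fin m → ℝ) :
    A.mulVec (∑ r, p r • U r) + B.transpose.mulVec (∑ r, p r • P r) = ∑ r, p r • f r ∧
      B.mulVec (∑ r, p r • U r) = 0 := by
  simp only [Matrix.mulVec_sum, Matrix.mulVec_smul, hU, smul_zero, Finset.sum_const_zero,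
    and_true, ← Finset.sum_add_distrib, ← smul_add, h]

theorem response_mulVec {G : Matrix (Fin m) (Fin m) ℝ} (hG : ∀ k r, G k r = -(f k ⬝ᵥ U r))
    (p : Fin m → ℝ) (k : Fin m) : G.mulVec p k = -(f k ⬝ᵥ ∑ r, p r • U r) := by
  simp only [Matrix.mulVec, dotProduct_sum, dotProduct_smul, smul_eq_mul]
  rw [dotProduct, ← Finset.sum_neg_distrib]
  exact Finset.sum_congr rfl fun r _ => by rw [hG]; ring

/-- The superposed velocity is tested against its own equation; the pressure does no work on it. -/
theorem response_quadratic_form {G : Matrix (Fin m) (Fin m) ℝ}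
    (hG : ∀ k r, G k r = -(f k ⬝ᵥ U r))
    (h : ∀ r, A.mulVec (U r) + B.transpose.mulVec (P r) = f r) (hU : ∀ r, B.mulVec (U r) = 0)
    (p : Fin m → ℝ) :
    p ⬝ᵥ G.mulVec p = -((∑ r, p r • U r) ⬝ᵥ A.mulVec (∑ r, p r • U r)) := by
  obtain ⟨h1, h2⟩ := saddlePoint_superposition h hU p
  have h3 : p ⬝ᵥ G.mulVec p = -((∑ r, p r • f r) ⬝ᵥ ∑ r, p r • U r) := by
    rw [dotProduct, sum_dotProduct, ← Finset.sum_neg_distrib]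
    refine Finset.sum_congr rfl fun k _ => ?_
    rw [response_mulVec hG, smul_dotProduct, smul_eq_mul]; ring
  rw [h3, ← h1, dotProduct_comm, dotProduct_add, dotProduct_transpose_mulVec_eq_zero h2, add_zero]

end SaddlePoint

/-! ### Integrals over triangles and segments. -/

open MeasureTheory Set

/-- The set of the points of the plane with nonnegative coordinates of sum at most one. -/
def referenceTriangle : Set Plane := {x | 0 ≤ x 0 ∧ 0 ≤ x 1 ∧ x 0 + x 1 ≤ 1}

theorem setIntegral_prod_referenceTriangle {F : ℝ × ℝ → ℝ} (hF : Continuous F) :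
    ∫ z in {z : ℝ × ℝ | 0 ≤ z.1 ∧ 0 ≤ z.2 ∧ z.1 + z.2 ≤ 1}, F z =
      ∫ s in (0 : ℝ)..1, ∫ t in (0 : ℝ)..(1 - s), F (s, t) := by
  set R : Set (ℝ × ℝ) := {z | 0 ≤ z.1 ∧ 0 ≤ z.2 ∧ z.1 + z.2 ≤ 1} with hR
  have hclosed : IsClosed R :=
    (isClosed_le continuous_const continuous_fst).inter
      ((isClosed_le continuous_const continuous_snd).inter
        (isClosed_le (continuous_fst.add continuous_snd) continuous_const))
  have hcompact : IsCompact R := by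
    refine (isCompact_Icc (a := ((0, 0) : ℝ × ℝ)) (b := (1, 1))).of_isClosed_subset hclosed ?_
    rintro ⟨s, t⟩ ⟨h1, h2, h3⟩
    simp only at h1 h2 h3
    exact ⟨⟨h1, h2⟩, ⟨by simp only; linarith, by simp only; linarith⟩⟩
  have hint : IntegrableOn F R volume := hF.continuousOn.integrableOn_compact hcompact
  rw [← integral_indicator hclosed.measurableSet, Measure.volume_eq_prod,
    integral_prod _ (by rw [← Measure.volume_eq_prod]; exact hint.integrable_indicator hclosed.measurableSet),
    intervalIntegral.integral_of_le zero_le_one, ← integral_Icc_eq_integral_Ioc,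
    ← integral_indicator measurableSet_Icc]
  refine integral_congr_ae (Filter.Eventually.of_forall fun s => ?_)
  by_cases hs : s ∈ Icc (0 : ℝ) 1
  · simp only [indicator_of_mem hs]
    rw [intervalIntegral.integral_of_le (by linarith [hs.2]), ← integral_Icc_eq_integral_Ioc,
      ← integral_indicator measurableSet_Icc]
    refine integral_congr_ae (Filter.Eventually.of_forall fun t => ?_)
    by_cases ht : t ∈ Icc (0 : ℝ) (1 - s)
    · rw [indicator_of_mem ht]
      refine indicator_of_mem (s := R) ?_ F
      exact ⟨hs.1, ht.1, by simp only; linarith [ht.2]⟩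
    · rw [indicator_of_notMem ht]
      refine indicator_of_notMem (s := R) ?_ F
      rintro ⟨h1, h2, h3⟩
      simp only at h1 h2 h3
      exact ht ⟨h2, by linarith⟩
  · simp only [indicator_of_notMem hs]
    refine integral_eq_zero_of_ae (Filter.Eventually.of_forall fun t => ?_)
    refine indicator_of_notMem ?_ _
    rintro ⟨h1, h2, h3⟩
    simp only at h1 h2 h3
    exact hs ⟨h1, by linarith⟩

theorem setIntegral_referenceTriangle {F : ℝ × ℝ → ℝ} (hF : Continuous F) :
    ∫ x in referenceTriangle, F (x 0, x 1) =
      ∫ s in (0 : ℝ)..1, ∫ t in (0 : ℝ)..(1 - s), F (s, t) := by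
  rw [← setIntegral_prod_referenceTriangle hF]
  have hmp := (volume_preserving_finTwoArrow ℝ).comp
    (EuclideanSpace.volume_preserving_symm_measurableEquiv_toLp (Fin 2))
  have hemb := (MeasurableEquiv.finTwoArrow (α := ℝ)).measurableEmbedding.comp
    (MeasurableEquiv.toLp 2 (Fin 2 → ℝ)).symm.measurableEmbedding
  rw [← hmp.setIntegral_preimage_emb hemb]
  rfl

/-- The linear map that takes the standard basis of the plane to `u`, `w`. -/
noncomputable def planeLinearMap (u w : Plane) : Plane →L[ℝ] Plane :=
  (EuclideanSpace.proj (0 : Fin 2)).smulRight u + (EuclideanSpace.proj (1 : Fin 2)).smulRight w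

theorem planeLinearMap_apply (u w x : Plane) : planeLinearMap u w x = x 0 • u + x 1 • w := rfl

/-- The determinant of two vectors of the plane. -/
def planeDet (u w : Plane) : ℝ := u 0 * w 1 - u 1 * w 0

theorem det_planeLinearMap (u w : Plane) : (planeLinearMap u w).det = planeDet u w := by
  rw [ContinuousLinearMap.det,
    ← LinearMap.det_toMatrix (EuclideanSpace.basisFun (Fin 2) ℝ).toBasis, Matrix.det_fin_two]
  simp [LinearMap.toMatrix_apply, planeLinearMap_apply, planeDet]
  ring

theorem planeLinearMap_injective {u w : Plane} (h : planeDet u w ≠ 0) :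
    Function.Injective (planeLinearMap u w) := by
  rw [injective_iff_map_eq_zero]
  intro x hx
  have h0 : x 0 * u 0 + x 1 * w 0 = 0 := congrArg (fun z : Plane => z 0) hx
  have h1 : x 0 * u 1 + x 1 * w 1 = 0 := congrArg (fun z : Plane => z 1) hx
  have e0 : x 0 * planeDet u w = 0 := by
    rw [planeDet]; linear_combination w 1 * h0 - w 0 * h1
  have e1 : x 1 * planeDet u w = 0 := by
    rw [planeDet]; linear_combination u 0 * h1 - u 1 * h0
  ext i
  fin_cases i
  · exact (mul_eq_zero.1 e0).resolve_right h
  · exact (mul_eq_zero.1 e1).resolve_right h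

theorem isClosed_referenceTriangle : IsClosed referenceTriangle := by
  have h0 : Continuous fun x : Plane => x 0 := by fun_prop
  have h1 : Continuous fun x : Plane => x 1 := by fun_prop
  exact (isClosed_le continuous_const h0).inter
    ((isClosed_le continuous_const h1).inter (isClosed_le (h0.add h1) continuous_const))

theorem setIntegral_image_referenceTriangle (a : Plane) {u w : Plane} (h : planeDet u w ≠ 0)
    {f : Plane → ℝ} (hf : Continuous f) :
    ∫ y in (fun x => a + planeLinearMap u w x) '' referenceTriangle, f y =
      |planeDet u w| * ∫ s in (0 : ℝ)..1, ∫ t in (0 : ℝ)..(1 - s), f (a + (s • u + t • w)) := by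
  rw [integral_image_eq_integral_abs_det_fderiv_smul volume
    isClosed_referenceTriangle.measurableSet (f' := fun _ => planeLinearMap u w)
    (fun x _ => ((planeLinearMap u w).hasFDerivAt.const_add a).hasFDerivWithinAt)
    (fun x _ y _ hxy => planeLinearMap_injective h (add_left_cancel hxy))]
  simp only [det_planeLinearMap, smul_eq_mul, integral_const_mul, planeLinearMap_apply]
  congr 1
  exact setIntegral_referenceTriangle (F := fun z => f (a + (z.1 • u + z.2 • w))) (by fun_prop)

/-- The integral over a segment with respect to arc length. -/
theorem setIntegral_segment_hausdorffMeasure {a b : Plane} (hab : a ≠ b) (f : Plane → ℝ) :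
    ∫ x in convexHull ℝ {a, b}, f x ∂(Measure.hausdorffMeasure 1 : Measure Plane) =
      dist a b * ∫ t in (0 : ℝ)..1, f (a + t • (b - a)) := by
  have hd : 0 < dist a b := dist_pos.2 hab
  have hn : ‖b - a‖ = dist a b := by rw [dist_comm, dist_eq_norm]
  set d := dist a b with hd'
  -- Parametrisation by arc length: as an isometry it carries Lebesgue measure on the line to the
  -- Hausdorff measure on its range.
  set g : ℝ → Plane := fun t => a + t • (d⁻¹ • (b - a)) with hg
  have hiso : Isometry g := by
    refine Isometry.of_dist_eq fun s t => ?_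
    rw [hg, dist_add_left, dist_eq_norm, ← sub_smul, norm_smul, norm_smul, hn, norm_inv,
      Real.norm_of_nonneg hd.le, inv_mul_cancel₀ hd.ne', mul_one, Real.dist_eq, Real.norm_eq_abs]
  have himg : convexHull ℝ {a, b} = g '' Icc 0 d := by
    rw [convexHull_pair, segment_eq_image']
    ext x
    constructor
    · rintro ⟨t, ht, rfl⟩
      refine ⟨t * d, ⟨mul_nonneg ht.1 hd.le, by nlinarith [ht.2]⟩, ?_⟩
      simp only [hg, smul_smul]
      rw [mul_assoc, mul_inv_cancel₀ hd.ne', mul_one]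
    · rintro ⟨t, ht, rfl⟩
      refine ⟨t * d⁻¹, ⟨mul_nonneg ht.1 (inv_nonneg.2 hd.le), ?_⟩, ?_⟩
      · rw [← div_eq_mul_inv]; exact (div_le_one hd).2 ht.2
      · simp only [hg, smul_smul]
  have hemb : MeasurableEmbedding g := hiso.isClosedEmbedding.measurableEmbedding
  have hpre : g ⁻¹' (g '' Icc 0 d) = Icc 0 d := preimage_image_eq _ hiso.injective
  have key : ∫ x in g '' Icc 0 d, f x ∂(Measure.hausdorffMeasure 1 : Measure Plane) =
      ∫ t in Icc 0 d, f (g t) := by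
    have h1 : (Measure.hausdorffMeasure 1 : Measure Plane).restrict (g '' Icc 0 d) =
        Measure.map g (volume.restrict (Icc 0 d)) := by
      have h2 := hiso.map_hausdorffMeasure (d := 1) (Or.inl zero_le_one)
      rw [hausdorffMeasure_real] at h2
      rw [← hpre, ← hemb.restrict_map, h2, hpre,
        Measure.restrict_restrict_of_subset (image_subset_range _ _)]
    rw [h1, hemb.integral_map]
  rw [himg, key, integral_Icc_eq_integral_Ioc, ← intervalIntegral.integral_of_le hd.le]
  have := intervalIntegral.integral_comp_mul_right (fun t => f (g t)) hd.ne' (a := 0) (b := 1)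
  rw [zero_mul, one_mul, smul_eq_mul] at this
  rw [← mul_inv_cancel_left₀ hd.ne' (∫ t in (0 : ℝ)..d, f (g t)), ← this]
  simp only [hg, smul_smul, mul_assoc, mul_inv_cancel₀ hd.ne', mul_one]

/-! ### Barycentric coordinates, their gradients and the geometry of one triangle. -/

namespace PoreMesh

variable {m : ℕ} {S : PoreMesh m}

namespace Cell

theorem bary_of_mem (T : S.Cell) {v : Plane} (hv : v ∈ T.1) :
    T.bary v = T.basis.coord ⟨v, hv⟩ := dif_pos hv

theorem bary_of_notMem (T : S.Cell) {v : Plane} (hv : v ∉ T.1) : T.bary v = 0 := dif_neg hv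

theorem bary_apply_of_notMem (T : S.Cell) {v : Plane} (hv : v ∉ T.1) (x : Plane) :
    T.bary v x = 0 := by
  rw [bary_of_notMem T hv]; rfl

theorem bary_self (T : S.Cell) {v : Plane} (hv : v ∈ T.1) : T.bary v v = 1 := by
  rw [bary_of_mem T hv]
  exact T.basis.coord_apply_eq ⟨v, hv⟩

theorem bary_ne (T : S.Cell) {v w : Plane} (hw : w ∈ T.1) (h : v ≠ w) : T.bary v w = 0 := by
  by_cases hv : v ∈ T.1
  · rw [bary_of_mem T hv]
    exact T.basis.coord_apply_ne (i := ⟨v, hv⟩) (j := ⟨w, hw⟩) fun h' => h (congrArg Subtype.val h')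
  · exact bary_apply_of_notMem T hv w

theorem sum_bary (T : S.Cell) (x : Plane) : ∑ v ∈ T.1, T.bary v x = 1 := by
  rw [← T.basis.sum_coord_apply_eq_one x, ← Finset.sum_coe_sort]
  exact Finset.sum_congr rfl fun v _ => by rw [bary_of_mem T v.2]

theorem sum_bary_smul (T : S.Cell) (x : Plane) : ∑ v ∈ T.1, T.bary v x • v = x := by
  conv_rhs => rw [← T.basis.linear_combination_coord_eq_self x]
  rw [← Finset.sum_coe_sort]
  exact Finset.sum_congr rfl fun v _ => by rw [bary_of_mem T v.2]; rfl

theorem mem_convexHull_iff (T : S.Cell) {x : Plane} :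
    x ∈ convexHull ℝ (T.1 : Set Plane) ↔ ∀ v ∈ T.1, 0 ≤ T.bary v x := by
  have hr : (T.1 : Set Plane) = range T.basis := Subtype.range_val.symm
  rw [hr, T.basis.convexHull_eq_nonneg_coord]
  constructor
  · intro h v hv
    rw [bary_of_mem T hv]
    exact h ⟨v, hv⟩
  · intro h v
    rw [← bary_of_mem T v.2]
    exact h v v.2

theorem bary_add (T : S.Cell) (v x w : Plane) :
    T.bary v (x + w) = T.bary v x + (T.bary v).linear w := by
  have := (T.bary v).map_vadd x w
  rw [vadd_eq_add, vadd_eq_add] at this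
  rw [add_comm, this, add_comm]

theorem linear_bary_sub (T : S.Cell) (v x y : Plane) :
    (T.bary v).linear (x - y) = T.bary v x - T.bary v y :=
  (T.bary v).linearMap_vsub x y

theorem continuous_bary (T : S.Cell) (v : Plane) : Continuous (T.bary v) :=
  (T.bary v).continuous_of_finiteDimensional

theorem hasFDerivAt_bary (T : S.Cell) (v x : Plane) :
    HasFDerivAt (T.bary v) (LinearMap.toContinuousLinearMap (T.bary v).linear) x := by
  have h : ⇑(T.bary v) =
      fun y => LinearMap.toContinuousLinearMap (T.bary v).linear y + T.bary v 0 := by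
    ext y
    have := bary_add T v 0 y
    rw [zero_add] at this
    rw [this, add_comm]; rfl
  rw [h]
  exact (ContinuousLinearMap.hasFDerivAt _).add_const _

/-- The constant gradient of a barycentric coordinate. -/
noncomputable def grad (T : S.Cell) (v : Plane) : Plane := gradient (T.bary v) 0

theorem inner_grad (T : S.Cell) (v w : Plane) :
    inner ℝ (T.grad v) w = (T.bary v).linear w := by
  rw [grad, gradient, InnerProductSpace.toDual_symm_apply, (hasFDerivAt_bary T v 0).fderiv]
  rfl

theorem linear_bary_single (T : S.Cell) (v : Plane) (i : Fin 2) :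
    (T.bary v).linear (EuclideanSpace.single i 1) = T.grad v i := by
  rw [← inner_grad, EuclideanSpace.inner_single_right]
  simp

theorem linear_bary_eq (T : S.Cell) (v w : Plane) :
    (T.bary v).linear w = T.grad v 0 * w 0 + T.grad v 1 * w 1 := by
  rw [← inner_grad, PiLp.inner_apply, Fin.sum_univ_two]
  simp [mul_comm]

theorem outNormal_eq (T : S.Cell) (e : Finset Plane) :
    T.outNormal e = ‖∑ v ∈ e, T.grad v‖⁻¹ • ∑ v ∈ e, T.grad v := rfl

/-- The points `a`, `b`, `c` are the three vertices of the triangle `T`. -/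
def IsTriple (T : S.Cell) (a b c : Plane) : Prop :=
  a ≠ b ∧ a ≠ c ∧ b ≠ c ∧ T.1 = {a, b, c}

theorem exists_isTriple (T : S.Cell) : ∃ a b c, T.IsTriple a b c := by
  obtain ⟨a, b, c, h1, h2, h3, h⟩ := Finset.card_eq_three.1 T.2.2
  exact ⟨a, b, c, h1, h2, h3, h⟩

theorem exists_isTriple_of_pair (T : S.Cell) {a b : Plane} (hab : a ≠ b)
    (he : {a, b} ⊆ T.1) : ∃ c, T.IsTriple a b c := by
  have h1 : (T.1 \ {a, b}).card = 1 := by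
    rw [Finset.card_sdiff_of_subset he, T.2.2, Finset.card_pair hab]
  obtain ⟨c, hcc⟩ := Finset.card_eq_one.1 h1
  have hcm : c ∈ T.1 \ {a, b} := by rw [hcc]; exact Finset.mem_singleton_self c
  simp only [Finset.mem_sdiff, Finset.mem_insert, Finset.mem_singleton, not_or] at hcm
  refine ⟨c, hab, fun h => hcm.2.1 h.symm, fun h => hcm.2.2 h.symm, ?_⟩
  rw [← Finset.union_sdiff_of_subset he, hcc]
  ext x
  simp

theorem exists_isTriple_of_edge (T : S.Cell) {e : Finset Plane} (he : e ⊆ T.1)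
    (hc : e.card = 2) : ∃ a b c, e = {a, b} ∧ T.IsTriple a b c := by
  obtain ⟨a, b, hab, rfl⟩ := Finset.card_eq_two.1 hc
  obtain ⟨c, h⟩ := T.exists_isTriple_of_pair hab he
  exact ⟨a, b, c, rfl, h⟩

namespace IsTriple

variable {T : S.Cell} {a b c : Plane}

theorem rotate (h : T.IsTriple a b c) : T.IsTriple b c a := by
  obtain ⟨h1, h2, h3, h4⟩ := h
  refine ⟨h3, h1.symm, h2.symm, ?_⟩
  rw [h4]; ext x; simp only [Finset.mem_insert, Finset.mem_singleton]; tauto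

theorem swap (h : T.IsTriple a b c) : T.IsTriple b a c := by
  obtain ⟨h1, h2, h3, h4⟩ := h
  refine ⟨h1.symm, h3, h2, ?_⟩
  rw [h4]; ext x; simp only [Finset.mem_insert, Finset.mem_singleton]; tauto

theorem mem_left (h : T.IsTriple a b c) : a ∈ T.1 := by rw [h.2.2.2]; simp
theorem mem_mid (h : T.IsTriple a b c) : b ∈ T.1 := by rw [h.2.2.2]; simp
theorem mem_right (h : T.IsTriple a b c) : c ∈ T.1 := by rw [h.2.2.2]; simp

theorem sum_eq {M : Type*} [AddCommMonoid M] (h : T.IsTriple a b c) (f : Plane → M) :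
    ∑ v ∈ T.1, f v = f a + f b + f c := by
  obtain ⟨h1, h2, h3, h4⟩ := h
  rw [h4, Finset.sum_insert (by simp [h1, h2]), Finset.sum_insert (by simp [h3]),
    Finset.sum_singleton, add_assoc]

theorem sum_bary (h : T.IsTriple a b c) (x : Plane) :
    T.bary a x + T.bary b x + T.bary c x = 1 := by
  rw [← h.sum_eq fun v => T.bary v x, Cell.sum_bary]

theorem grad_add (h : T.IsTriple a b c) : T.grad a + T.grad b = -T.grad c := by
  ext i
  have h0 := h.sum_bary 0
  have h1 := h.sum_bary (0 + EuclideanSpace.single i 1)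
  simp only [bary_add, linear_bary_single] at h1
  rw [PiLp.add_apply, PiLp.neg_apply]
  linarith

theorem bary_mid_eq (h : T.IsTriple a b c) (s t : ℝ) :
    T.bary b (a + (s • (b - a) + t • (c - a))) = s := by
  rw [bary_add, map_add, map_smul, map_smul, linear_bary_sub, linear_bary_sub,
    bary_self T h.mem_mid, bary_ne T h.mem_left h.1.symm, bary_ne T h.mem_right h.2.2.1]
  simp

theorem bary_right_eq (h : T.IsTriple a b c) (s t : ℝ) :
    T.bary c (a + (s • (b - a) + t • (c - a))) = t := by
  rw [bary_add, map_add, map_smul, map_smul, linear_bary_sub, linear_bary_sub,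
    bary_self T h.mem_right, bary_ne T h.mem_left h.2.1.symm, bary_ne T h.mem_mid h.2.2.1.symm]
  simp

theorem eq_of_bary (h : T.IsTriple a b c) (x : Plane) :
    a + (T.bary b x • (b - a) + T.bary c x • (c - a)) = x := by
  have h1 := T.sum_bary_smul x
  rw [h.sum_eq fun v => T.bary v x • v] at h1
  have h2 : T.bary a x = 1 - T.bary b x - T.bary c x := by linarith [h.sum_bary x]
  rw [h2] at h1
  conv_rhs => rw [← h1]
  module

theorem grad_equations (h : T.IsTriple a b c) :
    T.grad c 0 * (b - a) 0 + T.grad c 1 * (b - a) 1 = 0 ∧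
      T.grad c 0 * (c - a) 0 + T.grad c 1 * (c - a) 1 = 1 := by
  rw [← linear_bary_eq, ← linear_bary_eq, linear_bary_sub, linear_bary_sub,
    bary_self T h.mem_right, bary_ne T h.mem_left h.2.1.symm, bary_ne T h.mem_mid h.2.2.1.symm]
  simp

/-- The gradients of the coordinates of `b` and `c` are dual to `b - a` and `c - a`, so the two
determinants have product one. -/
theorem planeDet_ne_zero (h : T.IsTriple a b c) : planeDet (b - a) (c - a) ≠ 0 := by
  obtain ⟨h1, h2⟩ := h.grad_equations
  obtain ⟨h3, h4⟩ := h.rotate.rotate.swap.grad_equations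
  intro h0
  rw [planeDet] at h0
  refine one_ne_zero (α := ℝ) ?_
  linear_combination (T.grad b 0 * T.grad c 1 - T.grad b 1 * T.grad c 0) * h0 - h2 +
    (T.grad b 0 * (c - a) 0 + T.grad b 1 * (c - a) 1) * h1 -
    (T.grad c 0 * (c - a) 0 + T.grad c 1 * (c - a) 1) * h4

/-- Cramer's rule for `grad_equations`: up to the Jacobian, the gradient is the opposite edge vector
turned by a right angle. Hence its length is edge length over twice the area. -/
theorem planeDet_mul_grad (h : T.IsTriple a b c) :
    planeDet (b - a) (c - a) * T.grad c 0 = -(b - a) 1 ∧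
      planeDet (b - a) (c - a) * T.grad c 1 = (b - a) 0 := by
  obtain ⟨h1, h2⟩ := h.grad_equations
  rw [planeDet]
  constructor
  · linear_combination (c - a) 1 * h1 - (b - a) 1 * h2
  · linear_combination (b - a) 0 * h2 - (c - a) 0 * h1

theorem abs_planeDet_mul_norm_grad (h : T.IsTriple a b c) :
    |planeDet (b - a) (c - a)| * ‖T.grad c‖ = dist a b := by
  obtain ⟨h1, h2⟩ := h.planeDet_mul_grad
  have h3 : ‖planeDet (b - a) (c - a) • T.grad c‖ = ‖b - a‖ := by
    rw [EuclideanSpace.norm_eq, EuclideanSpace.norm_eq, Fin.sum_univ_two, Fin.sum_univ_two]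
    simp only [PiLp.smul_apply, smul_eq_mul, h1, h2, norm_neg]
    rw [add_comm]
  rw [dist_comm, dist_eq_norm, ← h3, norm_smul, Real.norm_eq_abs]

theorem grad_ne_zero (h : T.IsTriple a b c) : T.grad c ≠ 0 := by
  intro h0
  have := h.grad_equations.2
  rw [h0] at this
  simp at this

theorem convexHull_eq_image (h : T.IsTriple a b c) :
    convexHull ℝ (T.1 : Set Plane) =
      (fun x => a + planeLinearMap (b - a) (c - a) x) '' referenceTriangle := by
  ext y
  rw [T.mem_convexHull_iff, h.2.2.2]
  simp only [Finset.mem_insert, Finset.mem_singleton, forall_eq_or_imp, forall_eq]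
  constructor
  · rintro ⟨h1, h2, h3⟩
    refine ⟨!₂[T.bary b y, T.bary c y], ⟨h2, h3, ?_⟩, h.eq_of_bary y⟩
    have := h.sum_bary y
    change T.bary b y + T.bary c y ≤ 1
    linarith
  · rintro ⟨x, ⟨h1, h2, h3⟩, rfl⟩
    have e1 := h.bary_mid_eq (x 0) (x 1)
    have e2 := h.bary_right_eq (x 0) (x 1)
    have e3 := h.sum_bary (a + (x 0 • (b - a) + x 1 • (c - a)))
    simp only [planeLinearMap_apply]
    rw [e1, e2] at e3 ⊢
    exact ⟨by linarith, h1, h2⟩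

theorem setIntegral_bary (h : T.IsTriple a b c) {F : ℝ × ℝ → ℝ} (hF : Continuous F) :
    ∫ x in convexHull ℝ (T.1 : Set Plane), F (T.bary b x, T.bary c x) =
      |planeDet (b - a) (c - a)| * ∫ s in (0 : ℝ)..1, ∫ t in (0 : ℝ)..(1 - s), F (s, t) := by
  rw [h.convexHull_eq_image]
  have hc := hF.comp ((T.continuous_bary b).prodMk (T.continuous_bary c))
  refine (setIntegral_image_referenceTriangle a h.planeDet_ne_zero hc).trans ?_
  simp only [Function.comp_apply]
  simp only [h.bary_mid_eq, h.bary_right_eq]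

end IsTriple


/-! ### Moments of the barycentric coordinates. -/

theorem _root_.integral_cubic (x k₀ k₁ k₂ k₃ : ℝ) :
    ∫ t in (0 : ℝ)..x, (k₀ + k₁ * t + k₂ * t ^ 2 + k₃ * t ^ 3) =
      k₀ * x + k₁ * x ^ 2 / 2 + k₂ * x ^ 3 / 3 + k₃ * x ^ 4 / 4 := by
  have h : ∀ t ∈ uIcc 0 x, HasDerivAt
      (fun y : ℝ => k₀ * y + k₁ * y ^ 2 / 2 + k₂ * y ^ 3 / 3 + k₃ * y ^ 4 / 4)
      (k₀ + k₁ * t + k₂ * t ^ 2 + k₃ * t ^ 3) t := by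
    intro t _
    have := (((hasDerivAt_id t).const_mul k₀).add
      (((hasDerivAt_pow 2 t).const_mul k₁).div_const 2)).add
      (((hasDerivAt_pow 3 t).const_mul k₂).div_const 3) |>.add
      (((hasDerivAt_pow 4 t).const_mul k₃).div_const 4)
    refine this.congr_deriv ?_
    push_cast
    ring
  rw [intervalIntegral.integral_eq_sub_of_hasDerivAt h
    (Continuous.intervalIntegrable (by fun_prop) _ _)]
  ring

/-- The integral of a quadratic polynomial over the reference triangle. -/
theorem _root_.integral_referenceTriangle_quadratic (k₀ k₁ k₂ k₃ : ℝ) :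
    ∫ s in (0 : ℝ)..1, ∫ t in (0 : ℝ)..(1 - s), (k₀ + k₁ * s + k₂ * s ^ 2 + k₃ * (s * t)) =
      k₀ / 2 + k₁ / 6 + k₂ / 12 + k₃ / 24 := by
  have h : ∀ s : ℝ, ∫ t in (0 : ℝ)..(1 - s), (k₀ + k₁ * s + k₂ * s ^ 2 + k₃ * (s * t)) =
      k₀ + (k₁ - k₀ + k₃ / 2) * s + (k₂ - k₁ - k₃) * s ^ 2 + (k₃ / 2 - k₂) * s ^ 3 := by
    intro s
    have := integral_cubic (1 - s) (k₀ + k₁ * s + k₂ * s ^ 2) (k₃ * s) 0 0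
    rw [show (fun t : ℝ => k₀ + k₁ * s + k₂ * s ^ 2 + k₃ * (s * t)) = fun t =>
      k₀ + k₁ * s + k₂ * s ^ 2 + k₃ * s * t + 0 * t ^ 2 + 0 * t ^ 3 by funext t; ring, this]
    ring
  simp only [h]
  rw [integral_cubic]
  ring

/-- These four monomials suffice, because relabelling the vertices brings any vertex or pair of
vertices into the places of `b` and `c`. -/
theorem IsTriple.setIntegral_quadratic {T : S.Cell} {a b c : Plane} (h : T.IsTriple a b c)
    (k₀ k₁ k₂ k₃ : ℝ) :
    ∫ x in convexHull ℝ (T.1 : Set Plane),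
      (k₀ + k₁ * T.bary b x + k₂ * T.bary b x ^ 2 + k₃ * (T.bary b x * T.bary c x)) =
      |planeDet (b - a) (c - a)| * (k₀ / 2 + k₁ / 6 + k₂ / 12 + k₃ / 24) := by
  rw [← integral_referenceTriangle_quadratic]
  exact h.setIntegral_bary
    (F := fun z => k₀ + k₁ * z.1 + k₂ * z.1 ^ 2 + k₃ * (z.1 * z.2)) (by fun_prop)

/-- The area of a triangle of the mesh. -/
noncomputable def area (T : S.Cell) : ℝ := volume.real (convexHull ℝ (T.1 : Set Plane))

theorem setIntegral_const (T : S.Cell) (k : ℝ) :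
    ∫ _ in convexHull ℝ (T.1 : Set Plane), k = T.area * k := by
  rw [MeasureTheory.setIntegral_const, smul_eq_mul, area]

theorem IsTriple.area_eq {T : S.Cell} {a b c : Plane} (h : T.IsTriple a b c) :
    T.area = |planeDet (b - a) (c - a)| / 2 := by
  have := h.setIntegral_quadratic 1 0 0 0
  simp only [zero_mul, add_zero, T.setIntegral_const, mul_one] at this
  rw [this]; ring

theorem area_pos (T : S.Cell) : 0 < T.area := by
  obtain ⟨a, b, c, h⟩ := T.exists_isTriple
  rw [h.area_eq]
  have := abs_pos.2 h.planeDet_ne_zero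
  positivity

theorem exists_isTriple_of_mem (T : S.Cell) {v : Plane} (hv : v ∈ T.1) :
    ∃ a c, T.IsTriple a v c := by
  obtain ⟨a, b, c, h⟩ := T.exists_isTriple
  have hv' := hv
  rw [h.2.2.2] at hv'
  simp only [Finset.mem_insert, Finset.mem_singleton] at hv'
  rcases hv' with rfl | rfl | rfl
  · exact ⟨b, c, h.swap⟩
  · exact ⟨a, c, h⟩
  · exact ⟨b, a, h.rotate⟩

theorem setIntegral_bary (T : S.Cell) {v : Plane} (hv : v ∈ T.1) :
    ∫ x in convexHull ℝ (T.1 : Set Plane), T.bary v x = T.area / 3 := by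
  obtain ⟨a, c, h⟩ := T.exists_isTriple_of_mem hv
  have := h.setIntegral_quadratic 0 1 0 0
  simp only [zero_mul, add_zero, zero_add, one_mul] at this
  rw [this, h.area_eq]; ring

theorem setIntegral_bary_sq (T : S.Cell) {v : Plane} (hv : v ∈ T.1) :
    ∫ x in convexHull ℝ (T.1 : Set Plane), T.bary v x * T.bary v x = T.area / 6 := by
  obtain ⟨a, c, h⟩ := T.exists_isTriple_of_mem hv
  have := h.setIntegral_quadratic 0 0 1 0
  simp only [zero_mul, add_zero, zero_add, one_mul, pow_two] at this
  rw [this, h.area_eq]; ring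

theorem IsTriple.setIntegral_bary_mul {T : S.Cell} {a b c : Plane} (h : T.IsTriple a b c) :
    ∫ x in convexHull ℝ (T.1 : Set Plane), T.bary a x * T.bary b x = T.area / 12 := by
  have := h.rotate.rotate.setIntegral_quadratic 0 0 0 1
  simp only [zero_mul, zero_add, one_mul] at this
  rw [this, h.rotate.rotate.area_eq]; ring

theorem setIntegral_bary_mul (T : S.Cell) {v w : Plane} (hv : v ∈ T.1) (hw : w ∈ T.1)
    (hvw : v ≠ w) :
    ∫ x in convexHull ℝ (T.1 : Set Plane), T.bary v x * T.bary w x = T.area / 12 := by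
  obtain ⟨c, h⟩ := T.exists_isTriple_of_pair hvw
    (by intro x; simp only [Finset.mem_insert, Finset.mem_singleton]; rintro (rfl | rfl) <;> assumption)
  exact h.setIntegral_bary_mul

/-- The length of an edge times its outward normal is twice the area times the gradient of the
barycentric coordinates of the edge. -/
theorem IsTriple.dist_smul_outNormal {T : S.Cell} {a b c : Plane} (h : T.IsTriple a b c) :
    dist a b • T.outNormal {a, b} = (2 * T.area) • ∑ v ∈ {a, b}, T.grad v := by
  have hsum : ∑ v ∈ ({a, b} : Finset Plane), T.grad v = -T.grad c := by
    rw [Finset.sum_pair h.1, h.grad_add]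
  rw [outNormal_eq, hsum, norm_neg, smul_smul, ← h.abs_planeDet_mul_norm_grad, h.area_eq,
    mul_inv_cancel_right₀ (norm_ne_zero_iff.2 h.grad_ne_zero)]
  congr 1
  ring

end Cell

/-! ### Edge fluxes of the Lagrange basis and the divergence theorem on a triangle. -/

/-- Six times the mean over the edge `e` of the quadratic Lagrange function of the node `s`. -/
noncomputable def edgeWeight (s e : Finset Plane) : ℝ :=
  open Classical in if s ⊆ e then (if s.card = 1 then 1 else 4) else 0

namespace Cell

theorem quad_singleton (T : S.Cell) (v x : Plane) :
    T.quad {v} x = T.bary v x * (2 * T.bary v x - 1) := by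
  simp [quad]

theorem quad_pair (T : S.Cell) {v w : Plane} (h : v ≠ w) (x : Plane) :
    T.quad {v, w} x = 4 * (T.bary v x * T.bary w x) := by
  rw [quad, if_neg (by rw [Finset.card_pair h]; decide), Finset.prod_pair h]

theorem quad_eq_zero (T : S.Cell) {s : Finset Plane} {v x : Plane} (hv : v ∈ s)
    (h : T.bary v x = 0) : T.quad s x = 0 := by
  have h0 : ∏ v ∈ s, T.bary v x = 0 := Finset.prod_eq_zero hv h
  simp [quad, h0]

theorem contDiff_bary (T : S.Cell) (v : Plane) : ContDiff ℝ ⊤ (T.bary v) := by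
  have h : ⇑(T.bary v) =
      fun y => LinearMap.toContinuousLinearMap (T.bary v).linear y + T.bary v 0 := by
    ext y
    have := bary_add T v 0 y
    rw [zero_add] at this
    rw [this, add_comm]; rfl
  rw [h]
  exact (ContinuousLinearMap.contDiff _).add contDiff_const

theorem contDiff_quad (T : S.Cell) (s : Finset Plane) : ContDiff ℝ ⊤ (T.quad s) := by
  have hp : ContDiff ℝ ⊤ fun x => ∏ v ∈ s, T.bary v x :=
    contDiff_prod fun v _ => T.contDiff_bary v
  unfold quad
  split_ifs
  · exact hp.mul ((contDiff_const.mul hp).sub contDiff_const)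
  · exact contDiff_const.mul hp

theorem bary_of_mem_edge (T : S.Cell) {a b v : Plane} (ha : a ∈ T.1) (hb : b ∈ T.1)
    (hva : v ≠ a) (hvb : v ≠ b) (t : ℝ) : T.bary v (a + t • (b - a)) = 0 := by
  rw [bary_add, map_smul, linear_bary_sub, bary_ne T ha hva, bary_ne T hb hvb]
  simp

theorem exists_eq_singleton_or_pair {s : Finset Plane} (hs : s.Nonempty) (hc : s.card ≤ 2) :
    (∃ v, s = {v}) ∨ ∃ v w, v ≠ w ∧ s = {v, w} := by
  have : 0 < s.card := hs.card_pos
  obtain h | h : s.card = 1 ∨ s.card = 2 := by omega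
  · exact Or.inl (Finset.card_eq_one.1 h)
  · exact Or.inr (Finset.card_eq_two.1 h)

/-- Simpson's weights 1/6, 4/6, 1/6 for the endpoints and the midpoint. A node off the edge has zero
trace on it, since some vertex of the node has vanishing coordinate there. -/
theorem IsTriple.setIntegral_edge_quad {T : S.Cell} {a b c : Plane} (h : T.IsTriple a b c)
    {s : Finset Plane} (hs : s.Nonempty) (hc : s.card ≤ 2) :
    ∫ x in convexHull ℝ ({a, b} : Set Plane), T.quad s x
      ∂(Measure.hausdorffMeasure 1 : Measure Plane) = dist a b * (edgeWeight s {a, b} / 6) := by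
  rw [setIntegral_segment_hausdorffMeasure h.1]
  congr 1
  have e0 : ∀ t : ℝ, T.bary b (a + t • (b - a)) = t := fun t => by
    simpa using h.bary_mid_eq t 0
  have e1 : ∀ t : ℝ, T.bary a (a + t • (b - a)) = 1 - t := fun t => by
    have := h.sum_bary (a + t • (b - a))
    rw [e0, T.bary_of_mem_edge h.mem_left h.mem_mid h.2.1.symm h.2.2.1.symm] at this
    linarith
  by_cases hse : s ⊆ {a, b}
  · rw [edgeWeight, if_pos hse]
    rcases exists_eq_singleton_or_pair hs hc with ⟨v, rfl⟩ | ⟨v, w, hvw, rfl⟩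
    · rw [if_pos (Finset.card_singleton v)]
      simp only [quad_singleton]
      simp only [Finset.singleton_subset_iff, Finset.mem_insert, Finset.mem_singleton] at hse
      rcases hse with rfl | rfl
      · simp only [e1]
        rw [show (fun t : ℝ => (1 - t) * (2 * (1 - t) - 1)) =
          fun t => 1 + (-3) * t + 2 * t ^ 2 + 0 * t ^ 3 by funext t; ring, integral_cubic]
        norm_num
      · simp only [e0]
        rw [show (fun t : ℝ => t * (2 * t - 1)) =
          fun t => 0 + (-1) * t + 2 * t ^ 2 + 0 * t ^ 3 by funext t; ring, integral_cubic]
        norm_num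
    · have hcard : ({v, w} : Finset Plane).card = 2 := Finset.card_pair hvw
      have heq : ({v, w} : Finset Plane) = {a, b} := Finset.eq_of_subset_of_card_le hse (by
        rw [hcard, Finset.card_pair h.1])
      rw [if_neg (by rw [hcard]; decide), heq]
      simp only [quad_pair T h.1, e0, e1]
      rw [show (fun t : ℝ => 4 * ((1 - t) * t)) =
        fun t => 0 + 4 * t + (-4) * t ^ 2 + 0 * t ^ 3 by funext t; ring, integral_cubic]
      norm_num
  · rw [edgeWeight, if_neg hse]
    obtain ⟨v, hv, hvn⟩ := Finset.not_subset.1 hse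
    simp only [Finset.mem_insert, Finset.mem_singleton, not_or] at hvn
    simp [quad_eq_zero T hv (T.bary_of_mem_edge h.mem_left h.mem_mid hvn.1 hvn.2 _)]

/-- The flux of a velocity basis function through an edge of a triangle. -/
theorem setIntegral_edge_velBasis (T : S.Cell) {e : Finset Plane} (he : e ⊆ T.1)
    (hc : e.card = 2) (j : S.UDof) :
    ∫ x in convexHull ℝ (e : Set Plane), inner ℝ (T.velBasis j x) (T.outNormal e)
      ∂(Measure.hausdorffMeasure 1 : Measure Plane) =
      edgeWeight j.1.1 e * (T.area / 3) * ∑ v ∈ e, T.grad v j.2 := by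
  obtain ⟨a, b, c, rfl, h⟩ := T.exists_isTriple_of_edge he hc
  have h1 : ∀ x, inner ℝ (T.velBasis j x) (T.outNormal {a, b}) =
      T.outNormal {a, b} j.2 * T.quad j.1.1 x := by
    intro x
    rw [velBasis, EuclideanSpace.inner_single_left]
    simp [mul_comm]
  have h2 := congrArg (fun z : Plane => z j.2) h.dist_smul_outNormal
  simp only [PiLp.smul_apply, smul_eq_mul] at h2
  have h3 : (∑ v ∈ ({a, b} : Finset Plane), T.grad v) j.2 = ∑ v ∈ {a, b}, T.grad v j.2 := by
    simp [Finset.sum_pair h.1]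
  simp only [h1]
  rw [integral_const_mul, Finset.coe_pair, h.setIntegral_edge_quad
    (S.K.nonempty_of_mem_faces j.1.2.1) j.1.2.2.1]
  rw [h3] at h2
  linear_combination edgeWeight j.1.1 {a, b} / 6 * h2

theorem fderiv_quad_singleton (T : S.Cell) (v x : Plane) (i : Fin 2) :
    fderiv ℝ (T.quad {v}) x (EuclideanSpace.single i 1) =
      (4 * T.bary v x - 1) * T.grad v i := by
  have h0 := T.hasFDerivAt_bary v x
  have h : HasFDerivAt (T.quad {v}) _ x :=
    (h0.mul ((h0.const_mul 2).sub_const 1)).congr_of_eventuallyEq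
      (Filter.Eventually.of_forall fun y => T.quad_singleton v y)
  rw [h.fderiv]
  simp [linear_bary_single]
  ring

theorem fderiv_quad_pair (T : S.Cell) {v w : Plane} (hvw : v ≠ w) (x : Plane) (i : Fin 2) :
    fderiv ℝ (T.quad {v, w}) x (EuclideanSpace.single i 1) =
      4 * (T.bary v x * T.grad w i + T.bary w x * T.grad v i) := by
  have h : HasFDerivAt (T.quad {v, w}) _ x :=
    (((T.hasFDerivAt_bary v x).mul (T.hasFDerivAt_bary w x)).const_mul 4).congr_of_eventuallyEq
      (Filter.Eventually.of_forall fun y => T.quad_pair hvw y)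
  rw [h.fderiv]
  simp [linear_bary_single]
  ring

theorem fderiv_velBasis (T : S.Cell) (j : S.UDof) (x w : Plane) :
    fderiv ℝ (T.velBasis j) x w = EuclideanSpace.single j.2 (fderiv ℝ (T.quad j.1.1) x w) := by
  have hq : HasFDerivAt (T.quad j.1.1) _ x :=
    ((T.contDiff_quad j.1.1).differentiable (by simp) x).hasFDerivAt
  have h : HasFDerivAt (T.velBasis j)
      ((fderiv ℝ (T.quad j.1.1) x).smulRight (EuclideanSpace.single j.2 (1 : ℝ))) x := by
    refine (hq.smul_const (EuclideanSpace.single j.2 (1 : ℝ))).congr_of_eventuallyEq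
      (Filter.Eventually.of_forall fun y => ?_)
    ext i
    simp [velBasis]
  rw [h.fderiv]
  ext i
  simp

theorem planeDiv_velBasis (T : S.Cell) (j : S.UDof) (x : Plane) :
    planeDiv (T.velBasis j) x =
      fderiv ℝ (T.quad j.1.1) x (EuclideanSpace.single j.2 1) := by
  simp only [planeDiv, fderiv_velBasis]
  rw [Finset.sum_eq_single j.2]
  · simp
  · intro i _ hi
    simp [hi]
  · simp

theorem integrableOn_of_continuous (T : S.Cell) {f : Plane → ℝ} (hf : Continuous f) :
    IntegrableOn f (convexHull ℝ (T.1 : Set Plane)) :=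
  hf.continuousOn.integrableOn_compact (T.1.finite_toSet.isCompact_convexHull (𝕜 := ℝ))

theorem IsTriple.sum_edges {T : S.Cell} {a b c : Plane} (h : T.IsTriple a b c)
    (f : Finset Plane → ℝ) :
    ∑ e ∈ T.1.powersetCard 2, f e = f {a, b} + f {b, c} + f {c, a} := by
  obtain ⟨h1, h2, h3, h4⟩ := h
  have n1 : ({a, b} : Finset Plane) ≠ {b, c} := fun hh => by
    have : a ∈ ({b, c} : Finset Plane) := hh ▸ Finset.mem_insert_self a _
    simp [h1, h2] at this
  have n2 : ({a, b} : Finset Plane) ≠ {c, a} := fun hh => by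
    have : b ∈ ({c, a} : Finset Plane) := hh ▸ (by simp)
    simp [h1.symm, h3] at this
  have n3 : ({b, c} : Finset Plane) ≠ {c, a} := fun hh => by
    have : b ∈ ({c, a} : Finset Plane) := hh ▸ (by simp)
    simp [h1.symm, h3] at this
  have hE : T.1.powersetCard 2 = {{a, b}, {b, c}, {c, a}} := by
    refine (Finset.eq_of_subset_of_card_le ?_ ?_).symm
    · intro e
      simp only [Finset.mem_insert, Finset.mem_singleton, Finset.mem_powersetCard, h4]
      rintro (rfl | rfl | rfl)
      · exact ⟨fun x => by simp only [Finset.mem_insert, Finset.mem_singleton]; tauto,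
          Finset.card_pair h1⟩
      · exact ⟨fun x => by simp only [Finset.mem_insert, Finset.mem_singleton]; tauto,
          Finset.card_pair h3⟩
      · exact ⟨fun x => by simp only [Finset.mem_insert, Finset.mem_singleton]; tauto,
          Finset.card_pair h2.symm⟩
    · rw [Finset.card_powersetCard, T.2.2, Finset.card_eq_three.2 ⟨_, _, _, n1, n2, n3, rfl⟩]
      decide
  rw [hE, Finset.sum_insert (by simp [n1, n2]), Finset.sum_pair n3, add_assoc]

theorem setIntegral_fderiv_quad_singleton (T : S.Cell) {v : Plane} (hv : v ∈ T.1) (i : Fin 2) :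
    ∫ x in convexHull ℝ (T.1 : Set Plane), fderiv ℝ (T.quad {v}) x (EuclideanSpace.single i 1) =
      T.area / 3 * T.grad v i := by
  simp only [fderiv_quad_singleton]
  rw [integral_mul_const, integral_sub
    ((T.integrableOn_of_continuous (T.continuous_bary v)).const_mul 4)
    (T.integrableOn_of_continuous continuous_const), integral_const_mul, T.setIntegral_bary hv,
    T.setIntegral_const]
  ring

theorem setIntegral_fderiv_quad_pair (T : S.Cell) {v w : Plane} (hvw : v ≠ w) (hv : v ∈ T.1)
    (hw : w ∈ T.1) (i : Fin 2) :
    ∫ x in convexHull ℝ (T.1 : Set Plane), fderiv ℝ (T.quad {v, w}) x (EuclideanSpace.single i 1) =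
      4 * (T.area / 3) * (T.grad v i + T.grad w i) := by
  simp only [fderiv_quad_pair T hvw]
  rw [integral_const_mul, integral_add
    ((T.integrableOn_of_continuous (T.continuous_bary v)).mul_const _)
    ((T.integrableOn_of_continuous (T.continuous_bary w)).mul_const _), integral_mul_const,
    integral_mul_const, T.setIntegral_bary hv, T.setIntegral_bary hw]
  ring

theorem fderiv_quad_of_not_subset (T : S.Cell) {s : Finset Plane} (hs : ¬ s ⊆ T.1) (x : Plane) :
    fderiv ℝ (T.quad s) x = 0 := by
  obtain ⟨v, hv, hvT⟩ := Finset.not_subset.1 hs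
  have h : T.quad s = fun _ => 0 := funext fun y => quad_eq_zero T hv (T.bary_apply_of_notMem hvT y)
  rw [h]
  simp

theorem edgeWeight_of_not_subset {s e : Finset Plane} (h : ¬ s ⊆ e) : edgeWeight s e = 0 :=
  if_neg h

theorem edgeWeight_singleton {v : Plane} {e : Finset Plane} (h : v ∈ e) :
    edgeWeight {v} e = 1 := by
  rw [edgeWeight, if_pos (Finset.singleton_subset_iff.2 h), if_pos (Finset.card_singleton v)]

theorem edgeWeight_self {e : Finset Plane} (h : e.card = 2) : edgeWeight e e = 4 := by
  rw [edgeWeight, if_pos subset_rfl, if_neg (by omega)]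

/-- The divergence theorem for a velocity basis function on a triangle. -/
theorem setIntegral_planeDiv_velBasis (T : S.Cell) (j : S.UDof) :
    ∫ x in convexHull ℝ (T.1 : Set Plane), planeDiv (T.velBasis j) x =
      ∑ e ∈ T.1.powersetCard 2,
        edgeWeight j.1.1 e * (T.area / 3) * ∑ v ∈ e, T.grad v j.2 := by
  obtain ⟨⟨s, hs, hc, hw⟩, i⟩ := j
  simp only [planeDiv_velBasis]
  by_cases hsT : s ⊆ T.1
  · rcases exists_eq_singleton_or_pair (S.K.nonempty_of_mem_faces hs) hc with
      ⟨v, rfl⟩ | ⟨v, w, hvw, rfl⟩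
    · have hv : v ∈ T.1 := Finset.singleton_subset_iff.1 hsT
      rw [T.setIntegral_fderiv_quad_singleton hv]
      obtain ⟨a, c, h⟩ := T.exists_isTriple_of_mem hv
      -- Both edges at `v` carry flux; as the three gradients sum to zero, the two edge sums add up
      -- to the gradient at `v`.
      have hg : T.grad a i + T.grad v i = -T.grad c i := congrArg (fun z : Plane => z i) h.grad_add
      rw [h.sum_edges, edgeWeight_singleton (by simp), edgeWeight_singleton (by simp),
        edgeWeight_of_not_subset (by simp [h.1.symm, h.2.2.1]), Finset.sum_pair h.1,
        Finset.sum_pair h.2.2.1]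
      linear_combination (-T.area / 3) * hg
    · obtain ⟨c, h⟩ := T.exists_isTriple_of_pair hvw hsT
      rw [T.setIntegral_fderiv_quad_pair hvw h.mem_left h.mem_mid, h.sum_edges,
        edgeWeight_self (Finset.card_pair hvw),
        edgeWeight_of_not_subset (e := {w, c}) (by
          simp [Finset.insert_subset_iff, h.1, h.2.1]),
        edgeWeight_of_not_subset (e := {c, v}) (by
          simp [Finset.insert_subset_iff, h.1.symm, h.2.2.1]),
        Finset.sum_pair hvw]
      ring
  · rw [Finset.sum_eq_zero]
    · simp [T.fderiv_quad_of_not_subset hsT]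
    · intro e he
      rw [edgeWeight_of_not_subset fun h => hsT (h.trans (Finset.mem_powersetCard.1 he).1)]
      ring

/-! ### Triangles that share an edge. -/

theorem bary_eq_zero_of_mem_convexHull_pair (T : S.Cell) {a b v x : Plane} (ha : a ∈ T.1)
    (hb : b ∈ T.1) (hva : v ≠ a) (hvb : v ≠ b) (hx : x ∈ convexHull ℝ {a, b}) :
    T.bary v x = 0 := by
  rw [convexHull_pair, segment_eq_image'] at hx
  obtain ⟨t, -, rfl⟩ := hx
  exact T.bary_of_mem_edge ha hb hva hvb t

/-- Two different triangles with a common edge lie on different sides of it. -/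
theorem IsTriple.bary_opposite_neg {T T' : S.Cell} {a b c c' : Plane} (h : T.IsTriple a b c)
    (h' : T'.IsTriple a b c') (hne : T ≠ T') : T.bary c c' < 0 := by
  by_contra! hge
  have hcc : c ≠ c' := by
    rintro rfl
    exact hne (Subtype.ext (h.2.2.2.trans h'.2.2.2.symm))
  set α := T.bary a c'
  set β := T.bary b c'
  set ε : ℝ := 1 / (2 * (1 + |α| + |β|)) with hε
  have hpos : 0 < 1 + |α| + |β| := by positivity
  have hε0 : 0 < ε := by positivity
  have hε1 : ε * (1 + |α| + |β|) = 1 / 2 := by rw [hε]; field_simp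
  have hα : 0 ≤ ε * (|α| + α) := mul_nonneg hε0.le (by linarith [neg_abs_le α])
  have hβ : 0 ≤ ε * (|β| + β) := mul_nonneg hε0.le (by linarith [neg_abs_le β])
  have hα' : 0 ≤ ε * |α| := mul_nonneg hε0.le (abs_nonneg _)
  have hβ' : 0 ≤ ε * |β| := mul_nonneg hε0.le (abs_nonneg _)
  -- If `c'` were on the side of `c`, this point near the middle of the edge, moved slightly towards
  -- `c'`, would lie in both triangles but not on the edge, against conformity. The size of `ε`
  -- keeps its coordinates at `a` and `b` in `T` nonnegative.
  set x : Plane := a + (((1 - ε) / 2) • (b - a) + ε • (c' - a)) with hx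
  have e1 := h'.bary_mid_eq ((1 - ε) / 2) ε
  have e2 := h'.bary_right_eq ((1 - ε) / 2) ε
  have e3 := h'.sum_bary x
  rw [← hx] at e1 e2
  rw [e1, e2] at e3
  have hxT' : x ∈ convexHull ℝ (T'.1 : Set Plane) := by
    rw [T'.mem_convexHull_iff, h'.2.2.2]
    simp only [Finset.mem_insert, Finset.mem_singleton, forall_eq_or_imp, forall_eq, e1, e2]
    refine ⟨?_, ?_, hε0.le⟩ <;> linarith
  have hb : ∀ v, T.bary v x = T.bary v a + ((1 - ε) / 2 * (T.bary v b - T.bary v a) +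
      ε * (T.bary v c' - T.bary v a)) := by
    intro v
    rw [hx, bary_add, map_add, map_smul, map_smul, linear_bary_sub, linear_bary_sub]
    rfl
  have hxT : x ∈ convexHull ℝ (T.1 : Set Plane) := by
    rw [T.mem_convexHull_iff, h.2.2.2]
    simp only [Finset.mem_insert, Finset.mem_singleton, forall_eq_or_imp, forall_eq, hb,
      T.bary_self h.mem_left, T.bary_self h.mem_mid, T.bary_ne h.mem_left h.1.symm,
      T.bary_ne h.mem_mid h.1, T.bary_ne h.mem_left h.2.1.symm, T.bary_ne h.mem_mid h.2.2.1.symm]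
    refine ⟨?_, ?_, ?_⟩
    · change 0 ≤ 1 + ((1 - ε) / 2 * (0 - 1) + ε * (α - 1))
      linarith
    · change 0 ≤ 0 + ((1 - ε) / 2 * (1 - 0) + ε * (β - 0))
      linarith
    · have := mul_nonneg hε0.le hge
      linarith
  have hsub : (T.1 ∩ T'.1 : Set Plane) ⊆ {a, b} := by
    rintro v ⟨hv, hv'⟩
    rw [h.2.2.2] at hv
    rw [h'.2.2.2] at hv'
    simp only [Finset.coe_insert, Finset.coe_singleton, mem_insert_iff, mem_singleton_iff]
      at hv hv' ⊢
    rcases hv with rfl | rfl | rfl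
    · exact Or.inl rfl
    · exact Or.inr rfl
    · rcases hv' with h1 | h1 | h1
      · exact Or.inl h1
      · exact Or.inr h1
      · exact absurd h1 hcc
  have hmem := convexHull_mono hsub (S.K.inter_subset_convexHull T.2.1 T'.2.1 ⟨hxT, hxT'⟩)
  have := T'.bary_eq_zero_of_mem_convexHull_pair h'.mem_left h'.mem_mid h'.2.1.symm
    h'.2.2.1.symm hmem
  rw [e2] at this
  exact hε0.ne' this

/-- Both coordinates are affine and vanish on the line through `a` and `b`, so they are
proportional; the factor is read off at `c'`. -/
theorem IsTriple.grad_opposite {T T' : S.Cell} {a b c c' : Plane} (h : T.IsTriple a b c)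
    (h' : T'.IsTriple a b c') : T.grad c = T.bary c c' • T'.grad c' := by
  have key : ∀ x, T.bary c x = T.bary c c' * T'.bary c' x := by
    intro x
    conv_lhs => rw [← h'.eq_of_bary x]
    rw [bary_add, map_add, map_smul, map_smul, linear_bary_sub, linear_bary_sub,
      T.bary_ne h.mem_left h.2.1.symm, T.bary_ne h.mem_mid h.2.2.1.symm]
    simp [mul_comm]
  ext i
  rw [PiLp.smul_apply, smul_eq_mul, ← linear_bary_single, ← linear_bary_single,
    ← sub_zero (EuclideanSpace.single i (1 : ℝ)), linear_bary_sub, linear_bary_sub,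
    key (EuclideanSpace.single i 1), key 0]
  ring

theorem IsTriple.outNormal_eq_neg {T : S.Cell} {a b c : Plane} (h : T.IsTriple a b c) :
    T.outNormal {a, b} = -(‖T.grad c‖⁻¹ • T.grad c) := by
  rw [outNormal_eq, Finset.sum_pair h.1, h.grad_add, norm_neg, smul_neg]

theorem outNormal_ne_zero (T : S.Cell) {e : Finset Plane} (he : e ⊆ T.1) (hc : e.card = 2) :
    T.outNormal e ≠ 0 := by
  obtain ⟨a, b, c, rfl, h⟩ := T.exists_isTriple_of_edge he hc
  rw [h.outNormal_eq_neg, neg_ne_zero]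
  exact smul_ne_zero (inv_ne_zero (norm_ne_zero_iff.2 h.grad_ne_zero)) h.grad_ne_zero

/-- The outward normals of two different triangles on a common edge are opposite. -/
theorem outNormal_eq_neg_of_ne {T T' : S.Cell} (hne : T ≠ T') {e : Finset Plane} (he : e ⊆ T.1)
    (he' : e ⊆ T'.1) (hc : e.card = 2) : T.outNormal e = -T'.outNormal e := by
  obtain ⟨a, b, c, rfl, h⟩ := T.exists_isTriple_of_edge he hc
  obtain ⟨c', h'⟩ := T'.exists_isTriple_of_pair h.1 he'
  have hk := h.bary_opposite_neg h' hne
  rw [h.outNormal_eq_neg, h'.outNormal_eq_neg, h.grad_opposite h', norm_smul, Real.norm_eq_abs,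
    abs_of_neg hk, smul_smul, neg_neg, ← neg_smul]
  congr 1
  have := norm_ne_zero_iff.2 h'.grad_ne_zero
  have hk' := hk.ne
  field_simp

/-- Each side is half the edge length times an outward normal; the length is common and the normals
are opposite. -/
theorem area_mul_sum_grad_eq_neg {T T' : S.Cell} (hne : T ≠ T') {e : Finset Plane}
    (he : e ⊆ T.1) (he' : e ⊆ T'.1) (hc : e.card = 2) (i : Fin 2) :
    T.area * ∑ v ∈ e, T.grad v i = -(T'.area * ∑ v ∈ e, T'.grad v i) := by
  have hn := outNormal_eq_neg_of_ne hne he he' hc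
  obtain ⟨a, b, c, rfl, h⟩ := T.exists_isTriple_of_edge he hc
  obtain ⟨c', h'⟩ := T'.exists_isTriple_of_pair h.1 he'
  have h1 := congrArg (fun z : Plane => z i) h.dist_smul_outNormal
  have h2 := congrArg (fun z : Plane => z i) h'.dist_smul_outNormal
  have h3 := congrArg (fun z : Plane => z i) hn
  simp only [PiLp.smul_apply, smul_eq_mul, Finset.sum_pair h.1, PiLp.add_apply,
    PiLp.neg_apply] at h1 h2 h3 ⊢
  linear_combination (-1 / 2) * h1 - (1 / 2) * h2 + (dist a b / 2) * h3

end Cell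

variable (S) in
theorem exists_cell_of_face {s : Finset Plane} (hs : s ∈ S.K.faces) : ∃ T : S.Cell, s ⊆ T.1 := by
  obtain ⟨T, hT, hc, h⟩ := S.pure_dim_two s hs
  exact ⟨⟨T, hT, hc⟩, h⟩

/-- Purity of the complex supplies one triangle, so only uniqueness matters. -/
theorem isBoundaryEdge_iff {e : Finset Plane} (he : e ∈ S.K.faces) (hc : e.card = 2) :
    IsBoundaryEdge S.K e ↔ ∀ T T' : S.Cell, e ⊆ T.1 → e ⊆ T'.1 → T = T' := by
  constructor
  · rintro ⟨-, -, hu⟩ T T' hT hT'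
    exact Subtype.ext (hu.unique ⟨T.2.1, T.2.2, hT⟩ ⟨T'.2.1, T'.2.2, hT'⟩)
  · intro h
    obtain ⟨T, hT⟩ := S.exists_cell_of_face he
    refine ⟨he, hc, T.1, ⟨T.2.1, T.2.2, hT⟩, ?_⟩
    rintro T' ⟨h1, h2, h3⟩
    exact congrArg Subtype.val (h ⟨T', h1, h2⟩ T h3 hT)

open Classical in
/-- The contributions of the triangles at an edge that is not a boundary edge cancel. -/
theorem sum_area_mul_sum_grad_eq_zero {e : Finset Plane} (he : e ∈ S.K.faces) (hc : e.card = 2)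
    (hb : ¬ IsBoundaryEdge S.K e) (i : Fin 2) :
    ∑ T : S.Cell with e ⊆ T.1, T.area * ∑ v ∈ e, T.grad v i = 0 := by
  rw [isBoundaryEdge_iff he hc] at hb
  push Not at hb
  obtain ⟨T, T', hT, hT', hne⟩ := hb
  have hset : (Finset.univ.filter fun T : S.Cell => e ⊆ T.1) = {T, T'} := by
    ext T''
    simp only [Finset.mem_filter, Finset.mem_univ, true_and, Finset.mem_insert,
      Finset.mem_singleton]
    refine ⟨fun h'' => ?_, ?_⟩
    -- Three triangles at one edge would have pairwise opposite normals there, forcing a normal to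
    -- equal its own negative.
    · by_contra! hn
      have h1 := Cell.outNormal_eq_neg_of_ne hne hT hT' hc
      have h2 := Cell.outNormal_eq_neg_of_ne hn.1 h'' hT hc
      have h3 := Cell.outNormal_eq_neg_of_ne hn.2 h'' hT' hc
      refine T'.outNormal_ne_zero hT' hc ?_
      rw [h2, h1, neg_neg] at h3
      have h4 : (2 : ℝ) • T'.outNormal e = 0 := by
        rw [two_smul]
        exact add_eq_zero_iff_eq_neg.2 h3
      exact (smul_eq_zero.1 h4).resolve_left two_ne_zero
    · rintro (rfl | rfl) <;> assumption
  rw [hset, Finset.sum_pair hne, Cell.area_mul_sum_grad_eq_neg hne hT hT' hc, neg_add_cancel]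

/-! ### The interface loads and the constant pressure that balances their sum. -/

namespace Cell

/-- The flux of the velocity basis function `j` through the edge `e` of the triangle `T`. -/
noncomputable def flux (T : S.Cell) (e : Finset Plane) (j : S.UDof) : ℝ :=
  edgeWeight j.1.1 e * (T.area / 3) * ∑ v ∈ e, T.grad v j.2

end Cell

theorem iface_mem_faces {r : Fin m} {e : Finset Plane} (he : e ∈ S.iface r) : e ∈ S.K.faces :=
  (S.iface_boundary r e he).1

theorem iface_card {r : Fin m} {e : Finset Plane} (he : e ∈ S.iface r) : e.card = 2 :=
  (S.iface_boundary r e he).2.1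

theorem not_isWallEdge_of_iface {r : Fin m} {e : Finset Plane} (he : e ∈ S.iface r) :
    ¬ S.IsWallEdge e := fun h => h.2 r he

theorem iface_eq {r r' : Fin m} {e : Finset Plane} (he : e ∈ S.iface r) (he' : e ∈ S.iface r') :
    r = r' := by
  by_contra hne
  exact Finset.disjoint_left.1 (S.iface_disjoint r r' hne) he he'

open Classical in
theorem load_eq_sum_flux (r : Fin m) (j : S.UDof) :
    S.load r j = -∑ e ∈ S.iface r, ∑ T : S.Cell with e ⊆ T.1, T.flux e j := by
  rw [load]
  congr 1
  refine Finset.sum_congr rfl fun e he => Finset.sum_congr ?_ fun T hT => ?_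
  · congr
  · exact T.setIntegral_edge_velBasis (by simpa using hT) (iface_card he) j

/-- The nodal values of a discrete pressure, extended by zero to the whole plane. -/
noncomputable def nodalPressure (S : PoreMesh m) (P : S.PNode → ℝ) (v : Plane) : ℝ :=
  open Classical in if h : {v} ∈ S.K.faces then P ⟨v, h⟩ else 0

theorem singleton_mem_faces (T : S.Cell) {v : Plane} (hv : v ∈ T.1) : {v} ∈ S.K.faces :=
  S.K.down_closed T.2.1 (Finset.singleton_subset_iff.2 hv) (Finset.singleton_nonempty v)

/-- Passes from global pressure nodes to the vertices of one triangle, the only ones whose hat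
functions live there. -/
theorem sum_pNode (T : S.Cell) (P : S.PNode → ℝ) {f : Plane → ℝ} (hf : ∀ v ∉ T.1, f v = 0) :
    ∑ l : S.PNode, P l * f l.1 = ∑ v ∈ T.1, S.nodalPressure P v * f v := by
  classical
  have h1 : ∀ l : S.PNode, P l * f l.1 = S.nodalPressure P l.1 * f l.1 := by
    intro l
    rw [nodalPressure, dif_pos l.2]
    rfl
  simp only [h1]
  rw [← Finset.sum_image (f := fun v => S.nodalPressure P v * f v) (s := Finset.univ)
    (g := fun l : S.PNode => l.1) fun _ _ _ _ h => Subtype.ext h]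
  refine (Finset.sum_subset ?_ ?_).symm
  · intro v hv
    exact Finset.mem_image.2 ⟨⟨v, singleton_mem_faces T hv⟩, Finset.mem_univ _, rfl⟩
  · intro v _ hv
    rw [hf v hv, mul_zero]

theorem Cell.continuous_fderiv_quad (T : S.Cell) (s : Finset Plane) (w : Plane) :
    Continuous fun x => fderiv ℝ (T.quad s) x w :=
  ((T.contDiff_quad s).continuous_fderiv (by simp)).clm_apply continuous_const

theorem transpose_divMatrix_mulVec (P : S.PNode → ℝ) (j : S.UDof) :
    S.divMatrix.transpose.mulVec P j = -∑ T : S.Cell, ∑ v ∈ T.1, S.nodalPressure P v *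
      ∫ x in convexHull ℝ (T.1 : Set Plane),
        T.bary v x * fderiv ℝ (T.quad j.1.1) x (EuclideanSpace.single j.2 1) := by
  have h1 : ∀ T : S.Cell, ∑ v ∈ T.1, S.nodalPressure P v *
      ∫ x in convexHull ℝ (T.1 : Set Plane),
        T.bary v x * fderiv ℝ (T.quad j.1.1) x (EuclideanSpace.single j.2 1) =
      ∑ l : S.PNode, P l * ∫ x in convexHull ℝ (T.1 : Set Plane),
        T.bary l.1 x * planeDiv (T.velBasis j) x := by
    intro T
    simp only [T.planeDiv_velBasis]
    refine (sum_pNode T P fun v hv => ?_).symm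
    simp [T.bary_apply_of_notMem hv]
  simp only [h1]
  rw [Finset.sum_comm, Matrix.mulVec, dotProduct, ← Finset.sum_neg_distrib]
  refine Finset.sum_congr rfl fun l _ => ?_
  rw [← Finset.mul_sum, Matrix.transpose_apply, divMatrix, Matrix.of_apply]
  ring

/-- The hat functions sum to one on each triangle, which leaves the integral of the divergence, that
is, the flux through the three edges. -/
theorem transpose_divMatrix_mulVec_one (j : S.UDof) :
    S.divMatrix.transpose.mulVec 1 j =
      -∑ T : S.Cell, ∑ e ∈ T.1.powersetCard 2, T.flux e j := by
  rw [transpose_divMatrix_mulVec]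
  congr 1
  refine Finset.sum_congr rfl fun T _ => ?_
  refine Eq.trans ?_ (T.setIntegral_planeDiv_velBasis j)
  simp only [T.planeDiv_velBasis]
  have h1 : ∀ v ∈ T.1, S.nodalPressure 1 v * ∫ x in convexHull ℝ (T.1 : Set Plane),
      T.bary v x * fderiv ℝ (T.quad j.1.1) x (EuclideanSpace.single j.2 1) =
      ∫ x in convexHull ℝ (T.1 : Set Plane),
      T.bary v x * fderiv ℝ (T.quad j.1.1) x (EuclideanSpace.single j.2 1) := by
    intro v hv
    rw [nodalPressure, dif_pos (singleton_mem_faces T hv)]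
    exact one_mul _
  have h2 : ∀ v ∈ T.1, Integrable
      (fun x => T.bary v x * fderiv ℝ (T.quad j.1.1) x (EuclideanSpace.single j.2 1))
      (volume.restrict (convexHull ℝ (T.1 : Set Plane))) := fun v _ =>
    T.integrableOn_of_continuous ((T.continuous_bary v).mul (T.continuous_fderiv_quad _ _))
  rw [Finset.sum_congr rfl h1, ← integral_finsetSum _ h2]
  simp only [← Finset.sum_mul, T.sum_bary, one_mul]

-- On a wall edge every free basis function has zero trace; at an inner edge the weight is common to
-- both triangles and their normal contributions cancel.
open Classical in
theorem sum_flux_eq_zero {e : Finset Plane} (he : e ∈ S.K.faces) (hc : e.card = 2)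
    (hi : ∀ r, e ∉ S.iface r) (j : S.UDof) : ∑ T : S.Cell with e ⊆ T.1, T.flux e j = 0 := by
  by_cases hb : IsBoundaryEdge S.K e
  · refine Finset.sum_eq_zero fun T _ => ?_
    rw [Cell.flux, Cell.edgeWeight_of_not_subset (j.1.2.2.2 e ⟨hb, hi⟩)]
    ring
  · have h : ∀ T : S.Cell, T.flux e j =
        edgeWeight j.1.1 e / 3 * (T.area * ∑ v ∈ e, T.grad v j.2) := fun T => by
      rw [Cell.flux]; ring
    simp only [h]
    rw [← Finset.mul_sum, sum_area_mul_sum_grad_eq_zero he hc hb, mul_zero]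

/-- The loads of all the interfaces together are balanced by a constant pressure. -/
theorem sum_load_eq : ∑ r, S.load r = S.divMatrix.transpose.mulVec 1 := by
  classical
  ext j
  rw [transpose_divMatrix_mulVec_one, Finset.sum_apply]
  simp only [load_eq_sum_flux]
  rw [Finset.sum_neg_distrib]
  congr 1
  set E : Finset (Finset Plane) := S.finite_faces.toFinset.filter fun e => e.card = 2 with hE
  have hmem : ∀ e, e ∈ E ↔ e ∈ S.K.faces ∧ e.card = 2 := by simp [hE]
  -- The fluxes are regrouped by edges, after which only the interface edges survive.
  have h1 : ∑ T : S.Cell, ∑ e ∈ T.1.powersetCard 2, T.flux e j =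
      ∑ e ∈ E, ∑ T : S.Cell with e ⊆ T.1, T.flux e j := by
    refine Finset.sum_comm' fun T e => ?_
    simp only [Finset.mem_univ, true_and, Finset.mem_powersetCard, Finset.mem_filter, hmem]
    refine ⟨fun h => ⟨h.1, S.K.down_closed T.2.1 h.1 ?_, h.2⟩, fun h => ⟨h.1, h.2.2⟩⟩
    exact Finset.card_pos.1 (by omega)
  rw [h1, ← Finset.sum_biUnion fun r _ r' _ h => S.iface_disjoint r r' h]
  refine Finset.sum_subset ?_ ?_
  · intro e he
    obtain ⟨r, -, hr⟩ := Finset.mem_biUnion.1 he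
    exact (hmem e).2 ⟨iface_mem_faces hr, iface_card hr⟩
  · intro e he hn
    refine sum_flux_eq_zero ((hmem e).1 he).1 ((hmem e).1 he).2 (fun r hr => hn ?_) j
    exact Finset.mem_biUnion.2 ⟨r, Finset.mem_univ r, hr⟩

/-! ### Testing a balancing pressure with the midpoint functions of free edges. -/

/-- The velocity node at the midpoint of an edge that is not on the wall. -/
def edgeNode (e : Finset Plane) (he : e ∈ S.K.faces) (hc : e.card = 2)
    (hw : ¬ S.IsWallEdge e) : S.UNode :=
  ⟨e, he, hc.le, fun e' he' hs => hw
    ((Finset.eq_of_subset_of_card_le hs (by rw [hc, he'.1.2.1])) ▸ he')⟩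

/-- The contribution of one triangle to `Bᵀ q`, up to sign, at the midpoint of `a b`; the
coefficients come from the moments area/6 and area/12. -/
theorem Cell.IsTriple.setIntegral_bary_mul_fderiv_quad {T : S.Cell} {a b c : Plane}
    (h : T.IsTriple a b c) (q : Plane → ℝ) (i : Fin 2) :
    ∑ v ∈ T.1, q v * ∫ x in convexHull ℝ (T.1 : Set Plane),
      T.bary v x * fderiv ℝ (T.quad {a, b}) x (EuclideanSpace.single i 1) =
      T.area / 3 * (q a * (T.grad a i + 2 * T.grad b i) + q b * (2 * T.grad a i + T.grad b i) +
        q c * (T.grad a i + T.grad b i)) := by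
  have h1 : ∀ v, ∫ x in convexHull ℝ (T.1 : Set Plane),
      T.bary v x * fderiv ℝ (T.quad {a, b}) x (EuclideanSpace.single i 1) =
      4 * (T.grad b i * (∫ x in convexHull ℝ (T.1 : Set Plane), T.bary v x * T.bary a x) +
        T.grad a i * ∫ x in convexHull ℝ (T.1 : Set Plane), T.bary v x * T.bary b x) := by
    intro v
    have hi : ∀ w, IntegrableOn (fun x => T.bary v x * T.bary w x)
        (convexHull ℝ (T.1 : Set Plane)) := fun w =>
      T.integrableOn_of_continuous ((T.continuous_bary v).mul (T.continuous_bary w))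
    rw [← integral_const_mul, ← integral_const_mul, ← integral_add ((hi a).const_mul _)
      ((hi b).const_mul _), ← integral_const_mul]
    congr 1
    funext x
    rw [T.fderiv_quad_pair h.1]
    ring
  rw [h.sum_eq fun v => q v * ∫ x in convexHull ℝ (T.1 : Set Plane),
    T.bary v x * fderiv ℝ (T.quad {a, b}) x (EuclideanSpace.single i 1)]
  simp only [h1]
  rw [T.setIntegral_bary_sq h.mem_left, T.setIntegral_bary_sq h.mem_mid,
    T.setIntegral_bary_mul h.mem_left h.mem_mid h.1,
    T.setIntegral_bary_mul h.mem_mid h.mem_left h.1.symm,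
    T.setIntegral_bary_mul h.mem_right h.mem_left h.2.1.symm,
    T.setIntegral_bary_mul h.mem_right h.mem_mid h.2.2.1.symm]
  ring

open Classical in
theorem transpose_divMatrix_mulVec_edge (P : S.PNode → ℝ) {s : S.UNode} (i : Fin 2) :
    S.divMatrix.transpose.mulVec P (s, i) = -∑ T : S.Cell with s.1 ⊆ T.1,
      ∑ v ∈ T.1, S.nodalPressure P v * ∫ x in convexHull ℝ (T.1 : Set Plane),
        T.bary v x * fderiv ℝ (T.quad s.1) x (EuclideanSpace.single i 1) := by
  rw [transpose_divMatrix_mulVec, Finset.sum_filter]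
  congr 1
  refine Finset.sum_congr rfl fun T _ => ?_
  split_ifs with h
  · rfl
  · simp [T.fderiv_quad_of_not_subset h]

-- A midpoint function has zero trace on every other edge, so it feels at most the load on its own
-- edge.
open Classical in
theorem load_edge (r : Fin m) {s : S.UNode} (hc : s.1.card = 2) (i : Fin 2) :
    S.load r (s, i) = if s.1 ∈ S.iface r then
      -∑ T : S.Cell with s.1 ⊆ T.1, 4 * (T.area / 3) * ∑ v ∈ s.1, T.grad v i else 0 := by
  have h0 : ∀ e ∈ S.iface r, e ≠ s.1 → ∑ T : S.Cell with e ⊆ T.1, T.flux e (s, i) = 0 := by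
    intro e he hne
    refine Finset.sum_eq_zero fun T _ => ?_
    rw [Cell.flux, Cell.edgeWeight_of_not_subset]
    · ring
    · intro hs
      exact hne (Finset.eq_of_subset_of_card_le hs (by rw [hc, iface_card he])).symm
  rw [load_eq_sum_flux]
  split_ifs with h
  · rw [Finset.sum_eq_single s.1 h0 (fun hn => absurd h hn)]
    simp only [Cell.flux, Cell.edgeWeight_self hc]
  · rw [Finset.sum_eq_zero fun e he => h0 e he (by rintro rfl; exact h he), neg_zero]

variable {p : Fin m → ℝ} {P : S.PNode → ℝ}

/-- A pressure that balances a combination of interface loads is constant along every edge that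
is not on the wall. -/
theorem nodalPressure_eq_of_edge (h : ∑ r, p r • S.load r = S.divMatrix.transpose.mulVec P)
    {a b : Plane} (hab : a ≠ b) (he : {a, b} ∈ S.K.faces) (hw : ¬ S.IsWallEdge {a, b}) :
    S.nodalPressure P a = S.nodalPressure P b := by
  classical
  set s : S.UNode := edgeNode {a, b} he (Finset.card_pair hab) hw with hs
  have hs1 : s.1 = {a, b} := rfl
  have hg : ∀ T : S.Cell, {a, b} ⊆ T.1 →
      T.grad a 0 * (b - a) 0 + T.grad a 1 * (b - a) 1 = -1 ∧
      T.grad b 0 * (b - a) 0 + T.grad b 1 * (b - a) 1 = 1 := by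
    intro T hT
    have ha : a ∈ T.1 := hT (by simp)
    have hb : b ∈ T.1 := hT (by simp)
    rw [← T.linear_bary_eq, ← T.linear_bary_eq, T.linear_bary_sub, T.linear_bary_sub,
      T.bary_self ha, T.bary_self hb, T.bary_ne ha hab.symm, T.bary_ne hb hab]
    norm_num
  -- A normal traction does no work on the tangential direction `b - a`.
  have hl : ∀ r, S.load r (s, 0) * (b - a) 0 + S.load r (s, 1) * (b - a) 1 = 0 := by
    intro r
    rw [load_edge r (Finset.card_pair hab), load_edge r (Finset.card_pair hab), hs1]
    split_ifs
    · rw [neg_mul, neg_mul, Finset.sum_mul, Finset.sum_mul, ← neg_add, ← Finset.sum_add_distrib,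
        neg_eq_zero]
      refine Finset.sum_eq_zero fun T hT => ?_
      obtain ⟨h1, h2⟩ := hg T (by simpa using hT)
      rw [Finset.sum_pair hab, Finset.sum_pair hab]
      linear_combination 4 * (T.area / 3) * (h1 + h2)
    · ring
  have hr : ∀ i, ∑ r, p r * S.load r (s, i) = S.divMatrix.transpose.mulVec P (s, i) := by
    intro i
    rw [← h]
    simp
  have hsum : (∑ r, p r * S.load r (s, 0)) * (b - a) 0 +
      (∑ r, p r * S.load r (s, 1)) * (b - a) 1 = 0 := by
    rw [Finset.sum_mul, Finset.sum_mul, ← Finset.sum_add_distrib]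
    refine Finset.sum_eq_zero fun r _ => ?_
    linear_combination p r * hl r
  rw [hr, hr, transpose_divMatrix_mulVec_edge, transpose_divMatrix_mulVec_edge, hs1, neg_mul,
    neg_mul, ← neg_add, neg_eq_zero, Finset.sum_mul, Finset.sum_mul,
    ← Finset.sum_add_distrib] at hsum
  -- In the tangential direction the gradients at `a` and `b` contribute -1 and 1, so the value at
  -- the third vertex drops out.
  have hterm : ∀ T ∈ Finset.univ.filter (fun T : S.Cell => {a, b} ⊆ T.1),
      (∑ v ∈ T.1, S.nodalPressure P v * ∫ x in convexHull ℝ (T.1 : Set Plane),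
        T.bary v x * fderiv ℝ (T.quad {a, b}) x (EuclideanSpace.single 0 1)) * (b - a) 0 +
      (∑ v ∈ T.1, S.nodalPressure P v * ∫ x in convexHull ℝ (T.1 : Set Plane),
        T.bary v x * fderiv ℝ (T.quad {a, b}) x (EuclideanSpace.single 1 1)) * (b - a) 1 =
      T.area / 3 * (S.nodalPressure P a - S.nodalPressure P b) := by
    intro T hT
    have hT' : {a, b} ⊆ T.1 := by simpa using hT
    obtain ⟨c, htr⟩ := T.exists_isTriple_of_pair hab hT'
    obtain ⟨h1, h2⟩ := hg T hT'
    rw [htr.setIntegral_bary_mul_fderiv_quad, htr.setIntegral_bary_mul_fderiv_quad]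
    linear_combination T.area / 3 *
      ((S.nodalPressure P a + 2 * S.nodalPressure P b + S.nodalPressure P c) * h1 +
      (2 * S.nodalPressure P a + S.nodalPressure P b + S.nodalPressure P c) * h2)
  rw [Finset.sum_congr rfl hterm, ← Finset.sum_mul] at hsum
  obtain ⟨T, hT⟩ := S.exists_cell_of_face he
  -- The factors of `P a - P b` are positive on all triangles at the edge, so no cancellation is
  -- possible.
  have hpos : 0 < ∑ T : S.Cell with {a, b} ⊆ T.1, T.area / 3 :=
    Finset.sum_pos (fun T _ => by have := T.area_pos; positivity) ⟨T, by simpa using hT⟩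
  exact sub_eq_zero.1 ((mul_eq_zero.1 hsum).resolve_left (ne_of_gt hpos))

/-- If the pressure is constant on the triangle at an interface edge, its value is the traction. -/
theorem nodalPressure_eq_traction (h : ∑ r, p r • S.load r = S.divMatrix.transpose.mulVec P)
    {r : Fin m} {e : Finset Plane} (he : e ∈ S.iface r) {T : S.Cell} (hT : e ⊆ T.1) {κ : ℝ}
    (hκ : ∀ v ∈ T.1, S.nodalPressure P v = κ) : p r = κ := by
  classical
  obtain ⟨a, b, c, rfl, htr⟩ := T.exists_isTriple_of_edge hT (iface_card he)
  set s : S.UNode := edgeNode {a, b} (iface_mem_faces he) (Finset.card_pair htr.1)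
    (not_isWallEdge_of_iface he) with hs
  have hs1 : s.1 = {a, b} := rfl
  have hfilter : (Finset.univ.filter fun T : S.Cell => {a, b} ⊆ T.1) = {T} := by
    ext T'
    simp only [Finset.mem_filter, Finset.mem_univ, true_and, Finset.mem_singleton]
    refine ⟨fun h' => ?_, by rintro rfl; exact hT⟩
    exact (isBoundaryEdge_iff (iface_mem_faces he) (iface_card he)).1 (S.iface_boundary r _ he)
      T' T h' hT
  -- With constant pressure `κ` the right-hand side at this node is `κ` times the load of `r`, and
  -- no other interface acts there. What remains is `p r - κ` times a nonzero normal vector.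
  have key : ∀ i, (p r - κ) * (T.grad a i + T.grad b i) = 0 := by
    intro i
    have h1 := congrFun h (s, i)
    rw [Finset.sum_apply, Finset.sum_eq_single r, Pi.smul_apply, smul_eq_mul,
      load_edge r (Finset.card_pair htr.1), if_pos (hs1 ▸ he), transpose_divMatrix_mulVec_edge,
      hs1, hfilter, Finset.sum_singleton, Finset.sum_singleton, Finset.sum_pair htr.1,
      htr.setIntegral_bary_mul_fderiv_quad, hκ a htr.mem_left, hκ b htr.mem_mid,
      hκ c htr.mem_right] at h1
    · have h2 : T.area * ((p r - κ) * (T.grad a i + T.grad b i)) = 0 := by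
        linear_combination (-3 / 4) * h1
      exact (mul_eq_zero.1 h2).resolve_left T.area_pos.ne'
    · intro r' _ hr'
      rw [Pi.smul_apply, load_edge r' (Finset.card_pair htr.1), if_neg, smul_zero]
      exact fun h' => hr' (iface_eq h' he)
    · simp
  by_contra hne
  refine htr.grad_ne_zero ?_
  rw [← neg_eq_zero, ← htr.grad_add]
  ext i
  exact (mul_eq_zero.1 (key i)).resolve_left (sub_ne_zero.2 hne)

/-! ### Propagation of the pressure value through the mesh. -/

/-- Two edges of a triangle have a common vertex. -/
theorem Cell.exists_mem_inter (T : S.Cell) {e e' : Finset Plane} (he : e ⊆ T.1) (he' : e' ⊆ T.1)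
    (hc : e.card = 2) (hc' : e'.card = 2) : ∃ v ∈ e, v ∈ e' := by
  classical
  by_contra! hn
  have hd : Disjoint e e' := Finset.disjoint_left.2 hn
  have := Finset.card_le_card (Finset.union_subset he he')
  rw [Finset.card_union_of_disjoint hd, T.2.2] at this
  omega

theorem nodalPressure_eq_of_mem_edge
    (h : ∑ r, p r • S.load r = S.divMatrix.transpose.mulVec P)
    {e : Finset Plane} (he : e ∈ S.K.faces) (hc : e.card = 2) (hw : ¬ S.IsWallEdge e)
    {v w : Plane} (hv : v ∈ e) (hw' : w ∈ e) : S.nodalPressure P v = S.nodalPressure P w := by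
  obtain ⟨a, b, hab, rfl⟩ := Finset.card_eq_two.1 hc
  have := nodalPressure_eq_of_edge h hab he hw
  simp only [Finset.mem_insert, Finset.mem_singleton] at hv hw'
  rcases hv with rfl | rfl <;> rcases hw' with rfl | rfl <;> simp [this]

/-- The pressure takes the value `κ` on all the edges of `T` that are not on the wall. -/
def IsConstOnFreeEdges (S : PoreMesh m) (P : S.PNode → ℝ) (T : Finset Plane) (κ : ℝ) : Prop :=
  ∀ e ∈ S.K.faces, e.card = 2 → e ⊆ T → ¬ S.IsWallEdge e → ∀ v ∈ e, S.nodalPressure P v = κ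

theorem isConstOnFreeEdges_of_edge (h : ∑ r, p r • S.load r = S.divMatrix.transpose.mulVec P)
    (T : S.Cell) {e : Finset Plane} (hc : e.card = 2) (hT : e ⊆ T.1) {κ : ℝ}
    (hκ : ∀ v ∈ e, S.nodalPressure P v = κ) :
    IsConstOnFreeEdges S P T.1 κ := by
  intro e' he' hc' hT' hw' v hv
  obtain ⟨w, hwe, hwe'⟩ := T.exists_mem_inter hT hT' hc hc'
  rw [nodalPressure_eq_of_mem_edge h he' hc' hw' hv hwe', hκ w hwe]

theorem not_isWallEdge_of_ne {T T' : S.Cell} (hne : T ≠ T') {e : Finset Plane}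
    (hT : e ⊆ T.1) (hT' : e ⊆ T'.1) : ¬ S.IsWallEdge e := fun hw =>
  hne ((isBoundaryEdge_iff hw.1.1 hw.1.2.1).1 hw.1 T T' hT hT')

/-- The common edge of two different triangles is never on the wall, so it hands `κ` on. Only free
edges are tracked, as the tangential tests do not reach a vertex all of whose edges are on the wall.
-/
theorem isConstOnFreeEdges_of_cell (h : ∑ r, p r • S.load r = S.divMatrix.transpose.mulVec P)
    {T : S.Cell} {κ : ℝ} (hT : IsConstOnFreeEdges S P T.1 κ) (T' : S.Cell) :
    IsConstOnFreeEdges S P T'.1 κ := by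
  suffices ∀ B, Relation.ReflTransGen (fun A B : Finset Plane => B ∈ S.K.faces ∧ B.card = 3 ∧
      ∃ e ∈ S.K.faces, e.card = 2 ∧ e ⊆ A ∧ e ⊆ B) T.1 B →
      (B ∈ S.K.faces ∧ B.card = 3) ∧ IsConstOnFreeEdges S P B κ from
    (this T'.1 (S.connected T.1 T.2.1 T.2.2 T'.1 T'.2.1 T'.2.2)).2
  intro B hB
  induction hB with
  | refl => exact ⟨T.2, hT⟩
  | @tail A B _ hAB ih =>
    obtain ⟨hBf, hBc, e, he, hc, heA, heB⟩ := hAB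
    refine ⟨⟨hBf, hBc⟩, ?_⟩
    -- A chain may repeat a triangle, and then the common edge could be a wall edge.
    by_cases hne : A = B
    · exact hne ▸ ih.2
    · have hw : ¬ S.IsWallEdge e := not_isWallEdge_of_ne (T := ⟨A, ih.1⟩) (T' := ⟨B, hBf, hBc⟩)
        (fun hh => hne (congrArg Subtype.val hh)) heA heB
      exact isConstOnFreeEdges_of_edge h ⟨B, hBf, hBc⟩ hc heB (ih.2 e he hc heA hw)

/-- A triangle that is not the only one has an edge that is not a boundary edge. -/
theorem exists_inner_edge {T T' : S.Cell} (hne : T ≠ T') :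
    ∃ e ∈ S.K.faces, e.card = 2 ∧ e ⊆ T.1 ∧ ¬ IsBoundaryEdge S.K e := by
  have hc := S.connected T.1 T.2.1 T.2.2 T'.1 T'.2.1 T'.2.2
  have hne' : T.1 ≠ T'.1 := fun h => hne (Subtype.ext h)
  have hT := T.2
  revert hne' hT
  generalize T.1 = A at hc
  induction hc using Relation.ReflTransGen.head_induction_on with
  | refl => exact fun h _ => absurd rfl h
  | @head A B hAB _ ih =>
    intro hne' hA
    obtain ⟨hBf, hBc, e, he, hc, heA, heB⟩ := hAB
    by_cases hAB' : A = B
    · subst hAB'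
      exact ih hne' hA
    · refine ⟨e, he, hc, heA, fun hb => hAB' ?_⟩
      exact congrArg Subtype.val
        ((isBoundaryEdge_iff he hc).1 hb (⟨A, hA⟩ : S.Cell) ⟨B, hBf, hBc⟩ heA heB)

/-- If there is another interface, the triangle at an interface edge has a further edge that is not
on the wall. -/
theorem exists_second_free_edge {k r : Fin m} (hkr : k ≠ r) {e : Finset Plane}
    (he : e ∈ S.iface k) {T : S.Cell} (hT : e ⊆ T.1) :
    ∃ e' ∈ S.K.faces, e'.card = 2 ∧ e' ⊆ T.1 ∧ e' ≠ e ∧ ¬ S.IsWallEdge e' := by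
  obtain ⟨e₁, he₁⟩ := S.iface_nonempty r
  obtain ⟨T₁, hT₁⟩ := S.exists_cell_of_face (iface_mem_faces he₁)
  -- Either the triangle also carries an edge of the interface `r`, or the mesh has another triangle
  -- and the way to it leaves through an inner edge.
  by_cases hTT : T = T₁
  · subst hTT
    refine ⟨e₁, iface_mem_faces he₁, iface_card he₁, hT₁, ?_, not_isWallEdge_of_iface he₁⟩
    rintro rfl
    exact hkr (iface_eq he he₁)
  · obtain ⟨e', h1, h2, h3, h4⟩ := exists_inner_edge hTT
    refine ⟨e', h1, h2, h3, ?_, fun hw => h4 hw.1⟩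
    rintro rfl
    exact h4 (S.iface_boundary k _ he)

/-- Two distinct free edges cover all three vertices, so the pressure is `κ` on the whole triangle.
-/
theorem traction_eq_of_isConstOnFreeEdges
    (h : ∑ r, p r • S.load r = S.divMatrix.transpose.mulVec P) {k r : Fin m} (hkr : k ≠ r)
    {e : Finset Plane} (he : e ∈ S.iface k) {T : S.Cell} (hT : e ⊆ T.1) {κ : ℝ}
    (hκ : IsConstOnFreeEdges S P T.1 κ) : p k = κ := by
  classical
  obtain ⟨e', he', hc', hT', hne, hw'⟩ := exists_second_free_edge hkr he hT
  refine nodalPressure_eq_traction h he hT fun v hv => ?_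
  have hc := iface_card he
  have hlt : e.card < (e ∪ e').card := by
    refine Finset.card_lt_card ⟨Finset.subset_union_left, fun hs => hne ?_⟩
    exact Finset.eq_of_subset_of_card_le (Finset.subset_union_right.trans hs) (by omega)
  have hun : e ∪ e' = T.1 :=
    Finset.eq_of_subset_of_card_le (Finset.union_subset hT hT') (by rw [T.2.2]; omega)
  rw [← hun, Finset.mem_union] at hv
  rcases hv.symm with hv | hv
  · exact hκ e' he' hc' hT' hw' v hv
  · exact hκ e (iface_mem_faces he) hc hT (not_isWallEdge_of_iface he) v hv

/-- Interface tractions that are balanced by a pressure are uniform. -/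
theorem traction_uniform (h : ∑ r, p r • S.load r = S.divMatrix.transpose.mulVec P)
    (k r : Fin m) : p k = p r := by
  by_cases hkr : k = r
  · rw [hkr]
  obtain ⟨e, he⟩ := S.iface_nonempty k
  obtain ⟨T, hT⟩ := S.exists_cell_of_face (iface_mem_faces he)
  obtain ⟨e', he'⟩ := S.iface_nonempty r
  obtain ⟨T', hT'⟩ := S.exists_cell_of_face (iface_mem_faces he')
  obtain ⟨v, hv⟩ := S.K.nonempty_of_mem_faces (iface_mem_faces he)
  have h1 : IsConstOnFreeEdges S P T.1 (S.nodalPressure P v) :=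
    isConstOnFreeEdges_of_edge h T (iface_card he) hT fun w hw => nodalPressure_eq_of_mem_edge h (iface_mem_faces he)
        (iface_card he) (not_isWallEdge_of_iface he) hw hv
  rw [traction_eq_of_isConstOnFreeEdges h hkr he hT h1,
    traction_eq_of_isConstOnFreeEdges h (Ne.symm hkr) he' hT' (isConstOnFreeEdges_of_cell h h1 T')]

/-! ### Definiteness of the stiffness matrix. -/

namespace Cell

/-- The point of a triangle that belongs to a vertex or an edge is dual to the quadratic Lagrange
functions. -/
theorem exists_dual_point (T : S.Cell) {s' : Finset Plane} (hs' : s'.Nonempty)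
    (hc' : s'.card ≤ 2) (hT : s' ⊆ T.1) : ∃ x ∈ convexHull ℝ (T.1 : Set Plane),
      ∀ s : Finset Plane, s.Nonempty → s.card ≤ 2 →
        T.quad s x = open Classical in if s = s' then 1 else 0 := by
  classical
  rcases exists_eq_singleton_or_pair hs' hc' with ⟨a, rfl⟩ | ⟨a, b, hab, rfl⟩
  · have ha : a ∈ T.1 := Finset.singleton_subset_iff.1 hT
    refine ⟨a, subset_convexHull ℝ _ ha, fun s hs hc => ?_⟩
    rcases exists_eq_singleton_or_pair hs hc with ⟨v, rfl⟩ | ⟨v, w, hvw, rfl⟩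
    · by_cases hva : v = a
      · subst hva
        rw [quad_singleton, T.bary_self ha]
        norm_num
      · rw [T.quad_eq_zero (Finset.mem_singleton_self v) (T.bary_ne ha hva), if_neg]
        exact fun h => hva (Finset.singleton_injective h)
    · rw [if_neg]
      · by_cases hva : v = a
        · exact T.quad_eq_zero (v := w) (by simp) (T.bary_ne ha fun h => hvw (hva.trans h.symm))
        · exact T.quad_eq_zero (v := v) (by simp) (T.bary_ne ha hva)
      · intro h
        have := congrArg Finset.card h
        rw [Finset.card_pair hvw, Finset.card_singleton] at this
        omega
  · obtain ⟨c, h⟩ := T.exists_isTriple_of_pair hab hT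
    -- At the midpoint both coordinates are 1/2, where `λ (2 λ - 1)` vanishes and `4 λ μ` is 1.
    set x : Plane := a + (1 / 2 : ℝ) • (b - a) with hx
    have hxb : T.bary b x = 1 / 2 := by simpa [hx] using h.bary_mid_eq (1 / 2) 0
    have hx0 : ∀ v, v ≠ a → v ≠ b → T.bary v x = 0 := fun v hva hvb =>
      T.bary_of_mem_edge h.mem_left h.mem_mid hva hvb _
    have hxa : T.bary a x = 1 / 2 := by
      have := h.sum_bary x
      rw [hxb, hx0 c h.2.1.symm h.2.2.1.symm] at this
      linarith
    refine ⟨x, ?_, fun s hs hc => ?_⟩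
    · rw [T.mem_convexHull_iff, h.2.2.2]
      simp [hxa, hxb, hx0 c h.2.1.symm h.2.2.1.symm]
    · by_cases hsub : s ⊆ {a, b}
      · rcases exists_eq_singleton_or_pair hs hc with ⟨v, rfl⟩ | ⟨v, w, hvw, rfl⟩
        · rw [if_neg]
          · have hv : T.bary v x = 1 / 2 := by
              have hv := Finset.singleton_subset_iff.1 hsub
              simp only [Finset.mem_insert, Finset.mem_singleton] at hv
              rcases hv with rfl | rfl <;> assumption
            rw [quad_singleton, hv]
            norm_num
          · intro h
            have := congrArg Finset.card h
            rw [Finset.card_pair hab, Finset.card_singleton] at this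
            omega
        · have heq : ({v, w} : Finset Plane) = {a, b} := Finset.eq_of_subset_of_card_le hsub (by
            rw [Finset.card_pair hvw, Finset.card_pair hab])
          rw [heq, if_pos rfl, quad_pair T hab, hxa, hxb]
          norm_num
      · rw [if_neg fun h => hsub h.subset]
        obtain ⟨v, hv, hvn⟩ := Finset.not_subset.1 hsub
        simp only [Finset.mem_insert, Finset.mem_singleton, not_or] at hvn
        exact T.quad_eq_zero hv (hx0 v hvn.1 hvn.2)

theorem interior_convexHull_nonempty (T : S.Cell) :
    (interior (convexHull ℝ (T.1 : Set Plane))).Nonempty := by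
  have hr : (T.1 : Set Plane) = range T.basis := Subtype.range_val.symm
  rw [hr]
  exact ⟨_, T.basis.centroid_mem_interior_convexHull⟩

theorem subset_closure_interior (T : S.Cell) :
    convexHull ℝ (T.1 : Set Plane) ⊆ closure (interior (convexHull ℝ (T.1 : Set Plane))) := by
  rw [(convex_convexHull ℝ _).closure_interior_eq_closure_of_nonempty_interior
    T.interior_convexHull_nonempty]
  exact subset_closure

theorem eq_zero_of_setIntegral_eq_zero (T : S.Cell) {f : Plane → ℝ} (hf : Continuous f)
    (h0 : ∀ x, 0 ≤ f x) (h : ∫ x in convexHull ℝ (T.1 : Set Plane), f x = 0) {x : Plane}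
    (hx : x ∈ interior (convexHull ℝ (T.1 : Set Plane))) : f x = 0 := by
  have hae := (setIntegral_eq_zero_iff_of_nonneg_ae (Filter.Eventually.of_forall h0)
    (T.integrableOn_of_continuous hf)).1 h
  have hae' : f =ᵐ[volume.restrict (interior (convexHull ℝ (T.1 : Set Plane)))] 0 :=
    ae_restrict_of_ae_restrict_of_subset interior_subset hae
  exact Measure.eqOn_open_of_ae_eq hae' isOpen_interior hf.continuousOn continuousOn_const hx

/-- The nodes lie on the boundary of the triangle, so constancy on the connected interior is
extended to its closure. -/
theorem eq_of_fderiv_eq_zero (T : S.Cell) {w : Plane → ℝ} (hw : ContDiff ℝ ⊤ w)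
    (h : ∀ x ∈ interior (convexHull ℝ (T.1 : Set Plane)), fderiv ℝ w x = 0) {x y : Plane}
    (hx : x ∈ convexHull ℝ (T.1 : Set Plane)) (hy : y ∈ convexHull ℝ (T.1 : Set Plane)) :
    w x = w y := by
  obtain ⟨z, hz⟩ := T.interior_convexHull_nonempty
  have hconst : ∀ x ∈ interior (convexHull ℝ (T.1 : Set Plane)), w x = w z := fun x hx =>
    isOpen_interior.is_const_of_fderiv_eq_zero (convex_convexHull ℝ _).interior.isPreconnected
      (hw.differentiable (by simp)).differentiableOn h hx hz
  have hclosed : ∀ x ∈ convexHull ℝ (T.1 : Set Plane), w x = w z := fun x hx =>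
    closure_minimal (t := {x | w x = w z}) hconst
      (isClosed_eq hw.continuous continuous_const) (T.subset_closure_interior hx)
  rw [hclosed x hx, hclosed y hy]

theorem gradProd_velBasis (T : S.Cell) (j k : S.UDof) (x : Plane) :
    gradProd (T.velBasis k) (T.velBasis j) x = ∑ i : Fin 2, ∑ l : Fin 2,
      (if k.2 = i then fderiv ℝ (T.quad k.1.1) x (EuclideanSpace.single l 1) else 0) *
      (if j.2 = i then fderiv ℝ (T.quad j.1.1) x (EuclideanSpace.single l 1) else 0) := by
  simp only [gradProd, fderiv_velBasis]
  refine Finset.sum_congr rfl fun i _ => Finset.sum_congr rfl fun l _ => ?_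
  simp [eq_comm]

/-- The component `i` on `T` of the discrete velocity with coefficients `U`. -/
noncomputable def velComponent (T : S.Cell) (U : S.UDof → ℝ) (i : Fin 2) (x : Plane) : ℝ :=
  ∑ s : S.UNode, U (s, i) * T.quad s.1 x

theorem contDiff_velComponent (T : S.Cell) (U : S.UDof → ℝ) (i : Fin 2) :
    ContDiff ℝ ⊤ (T.velComponent U i) :=
  ContDiff.sum fun s _ => contDiff_const.mul (T.contDiff_quad s.1)

theorem fderiv_velComponent (T : S.Cell) (U : S.UDof → ℝ) (i : Fin 2) (x v : Plane) :
    fderiv ℝ (T.velComponent U i) x v = ∑ j : S.UDof, U j *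
      (if j.2 = i then fderiv ℝ (T.quad j.1.1) x v else 0) := by
  have h : HasFDerivAt (T.velComponent U i)
      (∑ s : S.UNode, U (s, i) • fderiv ℝ (T.quad s.1) x) x :=
    HasFDerivAt.fun_sum fun s _ =>
      (((T.contDiff_quad s.1).differentiable (by simp) x).hasFDerivAt).const_mul _
  rw [h.fderiv, Fintype.sum_prod_type]
  simp

end Cell

theorem stiffness_isSymm (S : PoreMesh m) (ν : ℝ) : (S.stiffness ν).IsSymm := by
  ext j k
  simp only [Matrix.transpose_apply, stiffness, Matrix.of_apply, gradProd, mul_comm]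

/-- Writes the energy as an integral of squares, so that its vanishing kills every partial
derivative on every triangle. -/
theorem dotProduct_stiffness_mulVec (ν : ℝ) (U : S.UDof → ℝ) :
    U ⬝ᵥ (S.stiffness ν).mulVec U = ν * ∑ T : S.Cell, ∫ x in convexHull ℝ (T.1 : Set Plane),
      ∑ i : Fin 2, ∑ l : Fin 2,
        (fderiv ℝ (T.velComponent U i) x (EuclideanSpace.single l 1)) ^ 2 := by
  have h1 : ∀ (T : S.Cell) (x : Plane), ∑ i : Fin 2, ∑ l : Fin 2,
        (fderiv ℝ (T.velComponent U i) x (EuclideanSpace.single l 1)) ^ 2 =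
      ∑ j : S.UDof, ∑ k : S.UDof, U j * U k * gradProd (T.velBasis k) (T.velBasis j) x := by
    intro T x
    simp only [Cell.fderiv_velComponent, Cell.gradProd_velBasis, pow_two, Finset.sum_mul_sum]
    simp only [Finset.mul_sum]
    rw [Finset.sum_congr rfl fun i _ => Finset.sum_comm, Finset.sum_comm]
    refine Finset.sum_congr rfl fun j _ => ?_
    rw [Finset.sum_congr rfl fun i _ => Finset.sum_comm, Finset.sum_comm]
    refine Finset.sum_congr rfl fun k _ => Finset.sum_congr rfl fun i _ =>
      Finset.sum_congr rfl fun l _ => ?_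
    ring
  have hc : ∀ (T : S.Cell) (j k : S.UDof),
      Continuous fun x => gradProd (T.velBasis k) (T.velBasis j) x := by
    intro T j k
    simp only [Cell.gradProd_velBasis]
    refine continuous_finsetSum _ fun i _ => continuous_finsetSum _ fun l _ =>
      Continuous.mul ?_ ?_
    · split_ifs
      · exact T.continuous_fderiv_quad _ _
      · exact continuous_const
    · split_ifs
      · exact T.continuous_fderiv_quad _ _
      · exact continuous_const
  have h2 : ∀ T : S.Cell, ∫ x in convexHull ℝ (T.1 : Set Plane), ∑ i : Fin 2, ∑ l : Fin 2,
        (fderiv ℝ (T.velComponent U i) x (EuclideanSpace.single l 1)) ^ 2 =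
      ∑ j : S.UDof, ∑ k : S.UDof, U j * U k *
        ∫ x in convexHull ℝ (T.1 : Set Plane), gradProd (T.velBasis k) (T.velBasis j) x := by
    intro T
    simp only [h1]
    rw [integral_finsetSum _ fun j _ => integrable_finsetSum _ fun k _ =>
      (T.integrableOn_of_continuous (hc T j k)).const_mul _]
    refine Finset.sum_congr rfl fun j _ => ?_
    rw [integral_finsetSum _ fun k _ =>
      (T.integrableOn_of_continuous (hc T j k)).const_mul _]
    exact Finset.sum_congr rfl fun k _ => integral_const_mul _ _
  simp only [h2]
  rw [Finset.sum_comm, Finset.mul_sum, dotProduct]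
  refine Finset.sum_congr rfl fun j _ => ?_
  rw [Finset.sum_comm, Finset.mul_sum, Matrix.mulVec, dotProduct, Finset.mul_sum]
  refine Finset.sum_congr rfl fun k _ => ?_
  rw [stiffness, Matrix.of_apply, ← Finset.mul_sum]
  ring

/-- The nodal values of a component of a discrete velocity, extended by zero to the wall. -/
noncomputable def nodalVelocity (S : PoreMesh m) (U : S.UDof → ℝ) (i : Fin 2)
    (s : Finset Plane) : ℝ :=
  open Classical in if h : s ∈ S.K.faces ∧ s.card ≤ 2 ∧ ∀ e, S.IsWallEdge e → ¬ s ⊆ e then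
    U (⟨s, h⟩, i) else 0

theorem Cell.exists_velComponent_eq (T : S.Cell) (U : S.UDof → ℝ) (i : Fin 2)
    {s' : Finset Plane} (hs' : s'.Nonempty) (hc' : s'.card ≤ 2) (hT : s' ⊆ T.1) :
    ∃ x ∈ convexHull ℝ (T.1 : Set Plane), T.velComponent U i x = S.nodalVelocity U i s' := by
  classical
  obtain ⟨x, hx, hq⟩ := T.exists_dual_point hs' hc' hT
  refine ⟨x, hx, ?_⟩
  have h1 : ∀ s : S.UNode, U (s, i) * T.quad s.1 x = if s.1 = s' then U (s, i) else 0 := by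
    intro s
    rw [hq s.1 (S.K.nonempty_of_mem_faces s.2.1) s.2.2.1]
    split_ifs <;> simp
  rw [velComponent]
  simp only [h1]
  rw [nodalVelocity]
  split_ifs with h
  · refine (Finset.sum_eq_single (⟨s', h⟩ : S.UNode) ?_ ?_).trans (if_pos rfl)
    · intro s _ hne
      exact if_neg fun hh => hne (Subtype.ext hh)
    · exact fun hn => (hn (Finset.mem_univ (α := S.UNode) _)).elim
  · exact Finset.sum_eq_zero fun s _ => if_neg fun (hh : s.1 = s') => h (hh ▸ s.2)

/-- By duality nodal values are point values, and a component with zero gradient is constant on the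
triangle. -/
theorem nodalVelocity_eq_of_cell {U : S.UDof → ℝ} {i : Fin 2} {T : S.Cell}
    (h : ∀ x ∈ interior (convexHull ℝ (T.1 : Set Plane)), fderiv ℝ (T.velComponent U i) x = 0)
    {s s' : Finset Plane} (hs : s.Nonempty) (hc : s.card ≤ 2) (hT : s ⊆ T.1)
    (hs' : s'.Nonempty) (hc' : s'.card ≤ 2) (hT' : s' ⊆ T.1) :
    S.nodalVelocity U i s = S.nodalVelocity U i s' := by
  obtain ⟨x, hx, h1⟩ := T.exists_velComponent_eq U i hs hc hT
  obtain ⟨y, hy, h2⟩ := T.exists_velComponent_eq U i hs' hc' hT'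
  rw [← h1, ← h2]
  exact T.eq_of_fderiv_eq_zero (T.contDiff_velComponent U i) h hx hy

/-- The stiffness matrix is definite, as the velocities vanish on the wall. -/
theorem stiffness_definite {ν : ℝ} (hν : 0 < ν) (U : S.UDof → ℝ)
    (hU : U ⬝ᵥ (S.stiffness ν).mulVec U = 0) : U = 0 := by
  rw [dotProduct_stiffness_mulVec] at hU
  have hcont : ∀ (T : S.Cell) (i l : Fin 2), Continuous fun x =>
      (fderiv ℝ (T.velComponent U i) x (EuclideanSpace.single l 1)) ^ 2 := fun T i l =>
    (((T.contDiff_velComponent U i).continuous_fderiv (by simp)).clm_apply continuous_const).pow 2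
  have hnn : ∀ (T : S.Cell) (x : Plane), 0 ≤ ∑ i : Fin 2, ∑ l : Fin 2,
      (fderiv ℝ (T.velComponent U i) x (EuclideanSpace.single l 1)) ^ 2 := fun T x =>
    Finset.sum_nonneg fun i _ => Finset.sum_nonneg fun l _ => sq_nonneg _
  have hsum := (mul_eq_zero.1 hU).resolve_left hν.ne'
  rw [Finset.sum_eq_zero_iff_of_nonneg fun T _ => setIntegral_nonneg_of_ae
    (Filter.Eventually.of_forall (hnn T))] at hsum
  have hgrad : ∀ (T : S.Cell) (i : Fin 2), ∀ x ∈ interior (convexHull ℝ (T.1 : Set Plane)),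
      fderiv ℝ (T.velComponent U i) x = 0 := by
    intro T i x hx
    have h0 := T.eq_zero_of_setIntegral_eq_zero
      (continuous_finsetSum _ fun i _ => continuous_finsetSum _ fun l _ => hcont T i l)
      (hnn T) (hsum T (Finset.mem_univ T)) hx
    have hl : ∀ l : Fin 2, fderiv ℝ (T.velComponent U i) x (EuclideanSpace.single l 1) = 0 := by
      intro l
      have h1 := (Finset.sum_eq_zero_iff_of_nonneg fun i _ =>
        Finset.sum_nonneg fun l _ => sq_nonneg _).1 h0 i (Finset.mem_univ i)
      have h2 := (Finset.sum_eq_zero_iff_of_nonneg fun l _ => sq_nonneg _).1 h1 l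
        (Finset.mem_univ l)
      exact pow_eq_zero_iff two_ne_zero |>.1 h2
    have h3 : (fderiv ℝ (T.velComponent U i) x : Plane →ₗ[ℝ] ℝ) = 0 :=
      (EuclideanSpace.basisFun (Fin 2) ℝ).toBasis.ext fun l => by simpa using hl l
    ext v
    exact congrArg (fun f : Plane →ₗ[ℝ] ℝ => f v) h3
  have hpos : ∀ {s : Finset Plane}, s.card = 2 → s.Nonempty := fun h =>
    Finset.card_pos.1 (by omega)
  obtain ⟨e₀, he₀⟩ := S.wall_nonempty
  obtain ⟨T₀, hT₀⟩ := S.exists_cell_of_face he₀.1.1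
  have key : ∀ (i : Fin 2) (B : Finset Plane), Relation.ReflTransGen
      (fun A B : Finset Plane => B ∈ S.K.faces ∧ B.card = 3 ∧
        ∃ e ∈ S.K.faces, e.card = 2 ∧ e ⊆ A ∧ e ⊆ B) T₀.1 B →
      (B ∈ S.K.faces ∧ B.card = 3) ∧
        ∀ s ⊆ B, s.Nonempty → s.card ≤ 2 → S.nodalVelocity U i s = 0 := by
    intro i B hB
    induction hB with
    | refl =>
      refine ⟨T₀.2, fun s hs hne hc => ?_⟩
      -- All nodes of the starting triangle share the value at the wall edge, which is the default
      -- zero.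
      rw [nodalVelocity_eq_of_cell (hgrad T₀ i) hne hc hs (hpos he₀.1.2.1) he₀.1.2.1.le hT₀,
        nodalVelocity, dif_neg]
      exact fun h => h.2.2 e₀ he₀ subset_rfl
    | @tail A B _ hAB ih =>
      obtain ⟨hBf, hBc, e, he, hc, heA, heB⟩ := hAB
      refine ⟨⟨hBf, hBc⟩, fun s hs hne hcs => ?_⟩
      rw [nodalVelocity_eq_of_cell (hgrad ⟨B, hBf, hBc⟩ i) hne hcs hs (hpos hc) hc.le heB]
      exact ih.2 e heA (hpos hc) hc.le
  ext ⟨s, i⟩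
  obtain ⟨T, hT⟩ := S.exists_cell_of_face s.2.1
  have h := (key i T.1 (S.connected T₀.1 T₀.2.1 T₀.2.2 T.1 T.2.1 T.2.2)).2 s.1 hT
    (S.K.nonempty_of_mem_faces s.2.1) s.2.2.1
  rw [nodalVelocity, dif_pos s.2] at h
  exact h

end PoreMesh

/-! ### The Dirichlet-to-Neumann matrix. -/

theorem lemma4 {m : ℕ} (S : PoreMesh m) (ν : ℝ) (hν : 0 < ν) :
    (∃! G : Matrix (Fin m) (Fin m) ℝ, S.IsDtN ν G) ∧
    ∀ G : Matrix (Fin m) (Fin m) ℝ, S.IsDtN ν G →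
      G.mulVec 1 = 0 ∧
      ∀ p : Fin m → ℝ, p ⬝ᵥ G.mulVec p = 0 ↔ ∀ k r, p k = p r := by
  have hdef := fun U => S.stiffness_definite hν U
  have hiff : ∀ r U P, S.IsUnitResponse ν r U P ↔
      (S.stiffness ν).mulVec U + S.divMatrix.transpose.mulVec P = S.load r ∧
        S.divMatrix.mulVec U = 0 := fun r U P => saddlePoint_mulVec_eq_iff
  have hone : ∀ G : Matrix (Fin m) (Fin m) ℝ, S.IsDtN ν G → G.mulVec 1 = 0 := by
    rintro G ⟨U, P, hUP, hG⟩
    obtain ⟨h1, h2⟩ := saddlePoint_superposition (fun r => ((hiff r _ _).1 (hUP r)).1)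
      (fun r => ((hiff r _ _).1 (hUP r)).2) 1
    have h3 : ∑ r, (1 : Fin m → ℝ) r • S.load r = S.divMatrix.transpose.mulVec 1 := by
      simpa using PoreMesh.sum_load_eq (S := S)
    -- Zero velocity with pressure one solves for the same load, so uniqueness of the velocity
    -- applies.
    have h4 : ∑ r, (1 : Fin m → ℝ) r • U r = 0 := by
      refine saddlePoint_velocity_unique hdef h1 h2 (P' := 1) ?_ (Matrix.mulVec_zero _)
      rw [Matrix.mulVec_zero, zero_add, h3]
    ext k
    rw [response_mulVec hG, h4, dotProduct_zero, neg_zero]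
    rfl
  refine ⟨?_, fun G hG => ⟨hone G hG, fun p => ⟨fun hp => ?_, fun hp => ?_⟩⟩⟩
  · choose U P hUP using fun r => exists_saddlePoint_solution (B := S.divMatrix)
      (S.stiffness_isSymm ν) hdef (S.load r)
    refine ⟨Matrix.of fun k r => -(S.load k ⬝ᵥ U r),
      ⟨U, P, fun r => (hiff r _ _).2 (hUP r), fun k r => rfl⟩, ?_⟩
    rintro G ⟨U', P', hUP', hG⟩
    ext k r
    obtain ⟨h1, h2⟩ := (hiff r _ _).1 (hUP' r)
    rw [hG, saddlePoint_velocity_unique hdef h1 h2 (hUP r).1 (hUP r).2]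
    rfl
  · obtain ⟨U, P, hUP, hG⟩ := hG
    have hs := fun r => ((hiff r _ _).1 (hUP r)).1
    have hd := fun r => ((hiff r _ _).1 (hUP r)).2
    rw [response_quadratic_form hG hs hd, neg_eq_zero] at hp
    have hU := hdef _ hp
    have h1 := (saddlePoint_superposition hs hd p).1
    -- With zero velocity the momentum equation says that the pressure alone balances the tractions.
    rw [hU, Matrix.mulVec_zero, zero_add] at h1
    exact PoreMesh.traction_uniform h1.symm
  -- Without interfaces there is no entry of `p` to serve as the common value.
  · rcases Nat.eq_zero_or_pos m with rfl | hm
    · simp [dotProduct]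
    · have h1 : p = p ⟨0, hm⟩ • 1 := by
        ext k
        simpa using hp k ⟨0, hm⟩
      rw [h1, Matrix.mulVec_smul, hone G hG, smul_zero, dotProduct_zero]
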